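/- **Theorem 1.** Consider finite sets $S$ of sellers and $B$ of buyers with a bipartite compatibility graph $G(S,B,E)$. Each agent $a\in S\cup B$ has finitely many ordered water units $w^a_1,\dots,w^a_{\gamma_a}$ and a value function $f_a:\{w^a_1,\dots,w^a_{\gamma_a}\}\to\mathbb{R}_{\ge 0}$. A trading assignment is a set $\mathcal{T}$ of pairs $(w^s_i,w^b_j)$, each formed by a unit of a seller $s$ and a unit of a buyer $b$ with $\{s,b\}\in E$, such that every water unit lies in at most one pair. Its welfare is $\sum_{(w^s_i,w^b_j)\in\mathcal{T}}\bigl(f_b(w^b_j)-f_s(w^s_i)\bigr)$. It is valid if (i) $f_b(w^b_j)\ge f_s(w^s_i)$ for every $(w^s_i,w^b_j)\in\mathcal{T}$, and (ii) for every agent $a\in S\cup B$ and every $i>1$, the unit $w^a_i$ is matched only if $w^a_{i-1}$ is matched. The problem MaxWelfare asks for a valid trading assignment whose welfare is maximum among all valid trading assignments. There is an algorithm, and a polynomial $p$, such that on every instance in which $f_s$ is monotone non-decreasing for every $s\in S$ and $f_b$ is monotone non-increasing for every $b\in B$ (that is, $f_s(w^s_i)\ge f_s(w^s_{i-1})$ and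 $f_b(w^b_i)\le f_b(w^b_{i-1})$ for all $i>1$), the algorithm outputs a solution of MaxWelfare within $p(n)$ steps, where $n=\sum_{a\in S\cup B}\gamma_a$ is the total number of water units. Here algorithms are programs of a random-access machine that at unit cost adds, subtracts and compares natural numbers, adds, subtracts and compares real numbers (the values), and reads and writes array cells; the input lists the units of the sellers and of the buyers in order, each with its owner, its position and its value, together with the adjacency matrix of $G$. -/

import Mathlib

open scoped NNReal

/-! ## The water market -/

/-- An instance of the water trading problem: sellers and buyers, the number of water units of
each agent (unit `i` of an agent precedes unit `i + 1`), nonnegative real values of the units, and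
the edge set of the bipartite seller-buyer compatibility graph. -/
structure WaterMarket where
  /-- number of sellers -/
  numSellers : ℕ
  /-- number of buyers -/
  numBuyers : ℕ
  /-- capacity of each seller -/
  sellerCap : Fin numSellers → ℕ
  /-- requirement of each buyer -/
  buyerCap : Fin numBuyers → ℕ
  /-- value functions of the sellers -/
  sellerValue : (s : Fin numSellers) → Fin (sellerCap s) → ℝ≥0
  /-- value functions of the buyers -/
  buyerValue : (b : Fin numBuyers) → Fin (buyerCap b) → ℝ≥0
  /-- edges of the compatibility graph -/
  compat : Finset (Fin numSellers × Fin numBuyers)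

namespace WaterMarket

/-- The water units of the sellers: unit `⟨s, i⟩` is the `i`-th unit of seller `s`. -/
abbrev SellerUnit (I : WaterMarket) : Type := (s : Fin I.numSellers) × Fin (I.sellerCap s)

/-- The water units of the buyers. -/
abbrev BuyerUnit (I : WaterMarket) : Type := (b : Fin I.numBuyers) × Fin (I.buyerCap b)

/-- The total number of water units of all agents. -/
def numUnits (I : WaterMarket) : ℕ := ∑ s, I.sellerCap s + ∑ b, I.buyerCap b

/-- A trading assignment: a matching of seller units with buyer units of compatible agents. -/
structure IsTrading (I : WaterMarket) (T : Finset (I.SellerUnit × I.BuyerUnit)) : Prop where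
  compatible : ∀ p ∈ T, (p.1.1, p.2.1) ∈ I.compat
  seller_unique : ∀ p ∈ T, ∀ q ∈ T, p.1 = q.1 → p = q
  buyer_unique : ∀ p ∈ T, ∀ q ∈ T, p.2 = q.2 → p = q

/-- The seller unit `u` is matched in `T`. -/
def SellerMatched (I : WaterMarket) (T : Finset (I.SellerUnit × I.BuyerUnit))
    (u : I.SellerUnit) : Prop := ∃ v, (u, v) ∈ T

/-- The buyer unit `v` is matched in `T`. -/
def BuyerMatched (I : WaterMarket) (T : Finset (I.SellerUnit × I.BuyerUnit))
    (v : I.BuyerUnit) : Prop := ∃ u, (u, v) ∈ T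

/-- A valid trading assignment: in every matched pair the buyer values the unit at least as much
as the seller, and a unit of an agent is matched only if the preceding unit of that agent is. -/
structure IsValid (I : WaterMarket) (T : Finset (I.SellerUnit × I.BuyerUnit)) : Prop
    extends I.IsTrading T where
  value_le : ∀ p ∈ T, I.sellerValue p.1.1 p.1.2 ≤ I.buyerValue p.2.1 p.2.2
  seller_order : ∀ (s : Fin I.numSellers) (i j : Fin (I.sellerCap s)), (i : ℕ) + 1 = j →
    I.SellerMatched T ⟨s, j⟩ → I.SellerMatched T ⟨s, i⟩
  buyer_order : ∀ (b : Fin I.numBuyers) (i j : Fin (I.buyerCap b)), (i : ℕ) + 1 = j →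
    I.BuyerMatched T ⟨b, j⟩ → I.BuyerMatched T ⟨b, i⟩

/-- The welfare of a trading assignment. -/
noncomputable def welfare (I : WaterMarket) (T : Finset (I.SellerUnit × I.BuyerUnit)) : ℝ :=
  ∑ p ∈ T, ((I.buyerValue p.2.1 p.2.2 : ℝ) - (I.sellerValue p.1.1 p.1.2 : ℝ))

/-- `T` solves MaxWelfare: it is a valid trading assignment of maximum welfare. -/
def IsMaxWelfare (I : WaterMarket) (T : Finset (I.SellerUnit × I.BuyerUnit)) : Prop :=
  I.IsValid T ∧ ∀ T', I.IsValid T' → I.welfare T' ≤ I.welfare T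

end WaterMarket

/-! ## Machine model: a random-access machine with unit cost

The memory consists of two-dimensional integer arrays (holding natural numbers) and
two-dimensional value arrays (holding real numbers), named by natural numbers. Cells are addressed
by computed integer indices. Integers can be added, subtracted (truncated at zero) and compared;
reals can be added, subtracted and compared, and nothing else: there is no multiplication, no
rounding, no passage between reals and integers except by comparison, and no real constant but
zero. Programs are while-programs, and every operation costs one step. -/

namespace RealRAM

/-- A memory state; `int a i j` and `val a i j` are the cells `(i, j)` of the arrays named `a`. -/
structure State where
  /-- the integer arrays -/
  int : ℕ → ℕ → ℕ → ℕ
  /-- the value arrays -/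
  val : ℕ → ℕ → ℕ → ℝ

/-- Write `n` in an integer cell. -/
def State.setInt (σ : State) (a i j n : ℕ) : State where
  int := fun a' i' j' => if a' = a ∧ i' = i ∧ j' = j then n else σ.int a' i' j'
  val := σ.val

/-- Write `x` in a value cell. -/
def State.setVal (σ : State) (a i j : ℕ) (x : ℝ) : State where
  int := σ.int
  val := fun a' i' j' => if a' = a ∧ i' = i ∧ j' = j then x else σ.val a' i' j'

/-- Integer expressions. -/
inductive IntExpr where
  | const (n : ℕ)
  | read (a : ℕ) (i j : IntExpr)
  | add (e f : IntExpr)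
  | sub (e f : IntExpr)

/-- The value of an integer expression. -/
def IntExpr.eval (σ : State) : IntExpr → ℕ
  | const n => n
  | read a i j => σ.int a (i.eval σ) (j.eval σ)
  | add e f => e.eval σ + f.eval σ
  | sub e f => e.eval σ - f.eval σ

/-- The number of operations in an integer expression. -/
def IntExpr.cost : IntExpr → ℕ
  | const _ => 1
  | read _ i j => i.cost + j.cost + 1
  | add e f => e.cost + f.cost + 1
  | sub e f => e.cost + f.cost + 1

/-- Real expressions. -/
inductive ValExpr where
  | zero
  | read (a : ℕ) (i j : IntExpr)
  | add (e f : ValExpr)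
  | sub (e f : ValExpr)

/-- The value of a real expression. -/
noncomputable def ValExpr.eval (σ : State) : ValExpr → ℝ
  | zero => 0
  | read a i j => σ.val a (i.eval σ) (j.eval σ)
  | add e f => e.eval σ + f.eval σ
  | sub e f => e.eval σ - f.eval σ

/-- The number of operations in a real expression. -/
def ValExpr.cost : ValExpr → ℕ
  | zero => 1
  | read _ i j => i.cost + j.cost + 1
  | add e f => e.cost + f.cost + 1
  | sub e f => e.cost + f.cost + 1

/-- Tests. -/
inductive Test where
  | intLe (e f : IntExpr)
  | valLe (e f : ValExpr)
  | not (t : Test)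
  | and (t u : Test)

/-- The test succeeds in the state `σ`. -/
def Test.Holds (σ : State) : Test → Prop
  | intLe e f => e.eval σ ≤ f.eval σ
  | valLe e f => e.eval σ ≤ f.eval σ
  | not t => ¬ t.Holds σ
  | and t u => t.Holds σ ∧ u.Holds σ

/-- The number of operations in a test. -/
def Test.cost : Test → ℕ
  | intLe e f => e.cost + f.cost + 1
  | valLe e f => e.cost + f.cost + 1
  | not t => t.cost + 1
  | and t u => t.cost + u.cost + 1

/-- Programs. `setInt a i j e` is the assignment `a[i, j] := e` to an integer cell, and
`setVal a i j e` the one to a value cell. -/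
inductive Program where
  | skip
  | setInt (a : ℕ) (i j e : IntExpr)
  | setVal (a : ℕ) (i j : IntExpr) (e : ValExpr)
  | seq (c d : Program)
  | ite (t : Test) (c d : Program)
  | loop (t : Test) (c : Program)

/-- `Runs c σ τ n`: started in the state `σ`, the program `c` halts in the state `τ` after exactly
`n` steps. (`loop t c` repeats `c` as long as `t` holds.) -/
inductive Runs : Program → State → State → ℕ → Prop
  | skip (σ : State) : Runs .skip σ σ 1
  | setInt (σ : State) (a : ℕ) (i j e : IntExpr) :
      Runs (.setInt a i j e) σ (σ.setInt a (i.eval σ) (j.eval σ) (e.eval σ))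
        (i.cost + j.cost + e.cost + 1)
  | setVal (σ : State) (a : ℕ) (i j : IntExpr) (e : ValExpr) :
      Runs (.setVal a i j e) σ (σ.setVal a (i.eval σ) (j.eval σ) (e.eval σ))
        (i.cost + j.cost + e.cost + 1)
  | seq {c d : Program} {σ τ ρ : State} {m n : ℕ} :
      Runs c σ τ m → Runs d τ ρ n → Runs (.seq c d) σ ρ (m + n)
  | ite_true {t : Test} {c d : Program} {σ τ : State} {n : ℕ} :
      t.Holds σ → Runs c σ τ n → Runs (.ite t c d) σ τ (t.cost + n)
  | ite_false {t : Test} {c d : Program} {σ τ : State} {n : ℕ} :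
      ¬ t.Holds σ → Runs d σ τ n → Runs (.ite t c d) σ τ (t.cost + n)
  | loop_done {t : Test} {c : Program} {σ : State} :
      ¬ t.Holds σ → Runs (.loop t c) σ σ t.cost
  | loop_step {t : Test} {c : Program} {σ τ ρ : State} {m n : ℕ} :
      t.Holds σ → Runs c σ τ m → Runs (.loop t c) τ ρ n → Runs (.loop t c) σ ρ (t.cost + m + n)

end RealRAM

/-! ## Input and output conventions -/

namespace WaterMarket

/-- The number of a seller unit in the list of all seller units: the units of seller `0` in their
order, then those of seller `1`, and so on. -/
def sellerIndex (I : WaterMarket) : I.SellerUnit ≃ Fin (∑ s, I.sellerCap s) := finSigmaFinEquiv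

/-- The number of a buyer unit in the list of all buyer units. -/
def buyerIndex (I : WaterMarket) : I.BuyerUnit ≃ Fin (∑ b, I.buyerCap b) := finSigmaFinEquiv

/-- The memory in which a computation on the instance `I` starts.

Integer arrays: `0[0, 0]` and `0[0, 1]` are the numbers of seller units and of buyer units;
`1[k, 0]` and `1[k, 1]` are the owner of the `k`-th seller unit and its position among the units
of its owner; `2[l, 0]` and `2[l, 1]` are the same for the `l`-th buyer unit; `3[s, b]` is `1` if
`s` and `b` are compatible. Value arrays: `0[0, k]` is the value of the `k`-th seller unit and
`0[1, l]` that of the `l`-th buyer unit. All other cells hold zero. -/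
noncomputable def input (I : WaterMarket) : RealRAM.State where
  int := fun a i j =>
    match a, i, j with
    | 0, 0, 0 => ∑ s, I.sellerCap s
    | 0, 0, 1 => ∑ b, I.buyerCap b
    | 1, k, 0 => if h : k < ∑ s, I.sellerCap s then (I.sellerIndex.symm ⟨k, h⟩).1 else 0
    | 1, k, 1 => if h : k < ∑ s, I.sellerCap s then (I.sellerIndex.symm ⟨k, h⟩).2 else 0
    | 2, l, 0 => if h : l < ∑ b, I.buyerCap b then (I.buyerIndex.symm ⟨l, h⟩).1 else 0
    | 2, l, 1 => if h : l < ∑ b, I.buyerCap b then (I.buyerIndex.symm ⟨l, h⟩).2 else 0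
    | 3, s, b => if h : s < I.numSellers ∧ b < I.numBuyers then
        (if ((⟨s, h.1⟩ : Fin I.numSellers), (⟨b, h.2⟩ : Fin I.numBuyers)) ∈ I.compat
          then 1 else 0) else 0
    | _, _, _ => 0
  val := fun a i j =>
    match a, i, j with
    | 0, 0, k => if h : k < ∑ s, I.sellerCap s then
        (I.sellerValue (I.sellerIndex.symm ⟨k, h⟩).1 (I.sellerIndex.symm ⟨k, h⟩).2 : ℝ) else 0
    | 0, 1, l => if h : l < ∑ b, I.buyerCap b then
        (I.buyerValue (I.buyerIndex.symm ⟨l, h⟩).1 (I.buyerIndex.symm ⟨l, h⟩).2 : ℝ) else 0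
    | _, _, _ => 0

/-- The memory `σ` presents the trading assignment `T` as output: the integer cell `4[k, 0]` is
`l + 1` if the `k`-th seller unit is matched with the `l`-th buyer unit, and `0` if the `k`-th
seller unit is unmatched. -/
def IsOutput (I : WaterMarket) (σ : RealRAM.State)
    (T : Finset (I.SellerUnit × I.BuyerUnit)) : Prop :=
  (∀ u v, (u, v) ∈ T → σ.int 4 (I.sellerIndex u) 0 = (I.buyerIndex v : ℕ) + 1) ∧
  (∀ u, ¬ I.SellerMatched T u → σ.int 4 (I.sellerIndex u) 0 = 0)

end WaterMarket

/-!
Keeping a seller unit can be viewed as selling it to an outside option that pays exactly the value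
of the unit. Together with the buyer units these options form the *items*, every seller unit gets
exactly one item, and up to a constant the welfare is the total value of the items in use. The sets
of items that can be matched with seller units are the independent sets of a transversal matroid,
so the greedy algorithm is optimal: take the items by decreasing value, and accept an item if the
accepted ones can still be matched.

Whether an item can be added is decided by an auction with integer prices
(`ItemMatching.IsAuction`): an item without a seller takes its cheapest neighbour, raises that
price by one and displaces the item that was there. If `m` is the number of seller units, there are
at most `m * m` bids until no item is displaced, or an item sees only prices of at least `m`. In
the latter case some price level is vacant, and the items above it violate Hall's condition
(`ItemMatching.IsAuction.exists_violator`); the matching from before the auction is then kept.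

A violation of Hall's condition gives, for each rejected item, a tight set of seller units: it
contains the neighbours of the rejected item, and it is filled by earlier items without neighbours
outside. The largest value of an item rejected because of a tight set containing a given seller
unit is the dual price of that unit, and linear programming duality yields optimality
(`ItemMatching.IsGreedy.sum_le`). Tight sets also yield validity
(`WaterMarket.isValid_trading`): units of one agent have the same compatible partners, and the
monotone value functions, with ties broken accordingly, put them in the right order in the greedy
algorithm.

The algorithm is written as a program of the machine in `RealRAM.greedyProgram`, and verified with
rules for total correctness with a bound on the number of steps (`RealRAM.Reaches`). It uses the
integer arrays `5` (items already considered), `6` (matching), `7` (tentative matching) and `8`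
(prices), and the variables `9` (selected item), `10` (item looking for a seller), `11` and `12`
(lowest price and cheapest seller), `13` (displaced item), `14`, `15` and `16` (loop counters).
Items are stored in matchings and variables with one added, so that zero means none.
-/

/-! ### Total correctness of programs with a bound on the number of steps -/

namespace RealRAM

/-- The names of the integer arrays that a program writes to. -/
def Program.targets : Program → List ℕ
  | .skip => []
  | .setInt a _ _ _ => [a]
  | .setVal _ _ _ _ => []
  | .seq c d => c.targets ++ d.targets
  | .ite _ c d => c.targets ++ d.targets
  | .loop _ c => c.targets

/-- The program never writes to a value array. -/
def Program.keepsVal : Program → Bool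
  | .skip => true
  | .setInt _ _ _ _ => true
  | .setVal _ _ _ _ => false
  | .seq c d => c.keepsVal && d.keepsVal
  | .ite _ c d => c.keepsVal && d.keepsVal
  | .loop _ c => c.keepsVal

theorem Runs.int_eq {c : Program} {σ τ : State} {t : ℕ} (h : Runs c σ τ t) :
    ∀ a, a ∉ c.targets → τ.int a = σ.int a := by
  induction h with
  | skip => intro a _; rfl
  | setInt σ a i j e =>
    intro a' ha
    simp only [Program.targets, List.mem_singleton] at ha
    funext i j
    simp [State.setInt, ha]
  | setVal => intro a _; rfl
  | seq _ _ ih₁ ih₂ =>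
    intro a ha
    simp only [Program.targets, List.mem_append, not_or] at ha
    rw [ih₂ a ha.2, ih₁ a ha.1]
  | ite_true _ _ ih =>
    intro a ha
    simp only [Program.targets, List.mem_append, not_or] at ha
    exact ih a ha.1
  | ite_false _ _ ih =>
    intro a ha
    simp only [Program.targets, List.mem_append, not_or] at ha
    exact ih a ha.2
  | loop_done => intro a _; rfl
  | loop_step _ _ _ ih₁ ih₂ =>
    intro a ha
    rw [ih₂ a ha, ih₁ a ha]

theorem Runs.val_eq {c : Program} {σ τ : State} {t : ℕ} (h : Runs c σ τ t) :
    c.keepsVal = true → τ.val = σ.val := by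
  induction h with
  | skip => intro _; rfl
  | setInt => intro _; rfl
  | setVal => intro h; simp [Program.keepsVal] at h
  | seq _ _ ih₁ ih₂ =>
    intro h
    simp only [Program.keepsVal, Bool.and_eq_true] at h
    rw [ih₂ h.2, ih₁ h.1]
  | ite_true _ _ ih =>
    intro h
    simp only [Program.keepsVal, Bool.and_eq_true] at h
    exact ih h.1
  | ite_false _ _ ih =>
    intro h
    simp only [Program.keepsVal, Bool.and_eq_true] at h
    exact ih h.2
  | loop_done => intro _; rfl
  | loop_step _ _ _ ih₁ ih₂ =>
    intro h
    rw [ih₂ h, ih₁ h]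

/-- `Reaches c σ n Q`: started in `σ`, the program `c` halts within `n` steps, in a state that
satisfies `Q`. -/
def Reaches (c : Program) (σ : State) (n : ℕ) (Q : State → Prop) : Prop :=
  ∃ τ t, Runs c σ τ t ∧ t ≤ n ∧ Q τ

/-- The state `τ` agrees with `σ` on all that the program `c` does not write to. -/
structure Agrees (c : Program) (σ τ : State) : Prop where
  int_eq : ∀ a, a ∉ c.targets → τ.int a = σ.int a
  val_eq : c.keepsVal = true → τ.val = σ.val

theorem Runs.agrees {c : Program} {σ τ : State} {t : ℕ} (h : Runs c σ τ t) : Agrees c σ τ :=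
  ⟨h.int_eq, h.val_eq⟩

theorem Agrees.refl (c : Program) (σ : State) : Agrees c σ σ := ⟨fun _ _ => rfl, fun _ => rfl⟩

theorem Agrees.trans {c : Program} {σ τ ρ : State} (h₁ : Agrees c σ τ) (h₂ : Agrees c τ ρ) :
    Agrees c σ ρ :=
  ⟨fun a ha => (h₂.int_eq a ha).trans (h₁.int_eq a ha),
    fun h => (h₂.val_eq h).trans (h₁.val_eq h)⟩

variable {c d : Program} {σ : State} {m n k : ℕ} {P Q : State → Prop}

theorem Reaches.mono (h : Reaches c σ m P) (hmn : m ≤ n) (hPQ : ∀ τ, Agrees c σ τ → P τ → Q τ) :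
    Reaches c σ n Q := by
  obtain ⟨τ, t, hr, ht, hP⟩ := h
  exact ⟨τ, t, hr, ht.trans hmn, hPQ τ hr.agrees hP⟩

theorem Reaches.setInt {a : ℕ} {i j e : IntExpr} (hn : i.cost + j.cost + e.cost + 1 ≤ n)
    (h : Q (σ.setInt a (i.eval σ) (j.eval σ) (e.eval σ))) :
    Reaches (.setInt a i j e) σ n Q :=
  ⟨_, _, .setInt σ a i j e, hn, h⟩

theorem Reaches.skip (hn : 1 ≤ n) (h : Q σ) : Reaches .skip σ n Q :=
  ⟨_, _, .skip σ, hn, h⟩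

theorem Reaches.seq (hc : Reaches c σ m P)
    (hd : ∀ τ, Agrees c σ τ → P τ → Reaches d τ n Q) (hk : m + n ≤ k) :
    Reaches (.seq c d) σ k Q := by
  obtain ⟨τ, t, hr, ht, hP⟩ := hc
  obtain ⟨ρ, s, hr', hs, hQ⟩ := hd τ hr.agrees hP
  exact ⟨ρ, t + s, .seq hr hr', by omega, hQ⟩

theorem Reaches.ite {t : Test} (hc : t.Holds σ → Reaches c σ n Q)
    (hd : ¬ t.Holds σ → Reaches d σ n Q) (hk : t.cost + n ≤ k) :
    Reaches (.ite t c d) σ k Q := by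
  by_cases ht : t.Holds σ
  · obtain ⟨τ, s, hr, hs, hQ⟩ := hc ht
    exact ⟨τ, _, .ite_true ht hr, by omega, hQ⟩
  · obtain ⟨τ, s, hr, hs, hQ⟩ := hd ht
    exact ⟨τ, _, .ite_false ht hr, by omega, hQ⟩

/-- The rule for while-loops: `Inv` is the invariant, and `v` bounds the number of further
iterations. -/
theorem Reaches.loop {t : Test} {Inv : State → Prop} (v : State → ℕ)
    (hstep : ∀ τ, Agrees c σ τ → Inv τ → t.Holds τ →
      Reaches c τ n fun ρ => Inv ρ ∧ v ρ < v τ)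
    (hσ : Inv σ) :
    Reaches (.loop t c) σ (v σ * (t.cost + n) + t.cost) fun τ => Inv τ ∧ ¬ t.Holds τ := by
  suffices H : ∀ r τ, v τ ≤ r → Agrees c σ τ → Inv τ →
      Reaches (.loop t c) τ (r * (t.cost + n) + t.cost) fun τ => Inv τ ∧ ¬ t.Holds τ from
    H _ σ le_rfl (.refl c σ) hσ
  intro r
  induction r with
  | zero =>
    intro τ hv ha hi
    by_cases ht : t.Holds τ
    · obtain ⟨ρ, s, -, -, -, hlt⟩ := hstep τ ha hi ht
      omega
    · exact ⟨τ, _, .loop_done ht, by omega, hi, ht⟩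
  | succ r ih =>
    intro τ hv ha hi
    by_cases ht : t.Holds τ
    · obtain ⟨ρ, s, hr, hs, hi', hlt⟩ := hstep τ ha hi ht
      obtain ⟨π, s', hr', hs', hQ⟩ := ih ρ (by omega) (ha.trans hr.agrees) hi'
      refine ⟨π, _, .loop_step ht hr hr', ?_, hQ⟩
      rw [add_mul]
      omega
    · exact ⟨τ, _, .loop_done ht, by omega, hi, ht⟩

/-- The integer variable `x`, kept in the cell `x[0, 0]`. -/
def IntExpr.var (x : ℕ) : IntExpr := .read x (.const 0) (.const 0)

/-- The entry `a[i, 0]` of a one-dimensional array. -/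
def IntExpr.entry (a : ℕ) (i : IntExpr) : IntExpr := .read a i (.const 0)

/-- The assignment `x := e`. -/
def Program.assign (x : ℕ) (e : IntExpr) : Program := .setInt x (.const 0) (.const 0) e

/-- The assignment `a[i, 0] := e`. -/
def Program.store (a : ℕ) (i e : IntExpr) : Program := .setInt a i (.const 0) e

/-- The loop `for x = 0, …, e - 1 do c`; the bound `e` is evaluated before each iteration. -/
def Program.forLoop (x : ℕ) (e : IntExpr) (c : Program) : Program :=
  .seq (.assign x (.const 0))
    (.loop (.intLe (.add (.var x) (.const 1)) e)
      (.seq c (.assign x (.add (.var x) (.const 1)))))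

/-- The rule for for-loops: `Inv i` holds before the iteration with `x = i`. The invariant must not
speak of the variable `x` itself. -/
theorem Reaches.forLoop {x : ℕ} {e : IntExpr} (r : ℕ) {Inv : ℕ → State → Prop}
    (hx : x ∉ c.targets)
    (he : ∀ τ, Agrees (.forLoop x e c) σ τ → e.eval τ = r)
    (hInv : ∀ i τ ρ, (∀ a, a ≠ x → ρ.int a = τ.int a) → Inv i τ → Inv i ρ)
    (hσ : Inv 0 σ)
    (hstep : ∀ i τ, i < r → Agrees (.forLoop x e c) σ τ → τ.int x 0 0 = i → Inv i τ →
      Reaches c τ n (Inv (i + 1))) :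
    Reaches (.forLoop x e c) σ (4 + (r * ((6 + e.cost) + (n + 8)) + (6 + e.cost))) (Inv r) := by
  have hmem : x ∈ (Program.forLoop x e c).targets := by
    simp [Program.forLoop, Program.targets, Program.assign]
  have hbody : ∀ τ ρ, Agrees (.seq c (.assign x (.add (.var x) (.const 1)))) τ ρ →
      Agrees (.forLoop x e c) τ ρ := by
    intro τ ρ h
    refine ⟨fun a ha => h.int_eq a ?_, fun hv => h.val_eq ?_⟩
    · simp only [Program.forLoop, Program.targets, Program.assign, List.mem_append, not_or]
        at ha ⊢
      exact ha.2
    · simp only [Program.forLoop, Program.keepsVal, Program.assign, Bool.and_eq_true] at hv ⊢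
      exact hv.2
  have hset : ∀ (τ : State) (v : ℕ) (a : ℕ), a ≠ x → (τ.setInt x 0 0 v).int a = τ.int a := by
    intro τ v a ha
    funext i j
    simp [State.setInt, ha]
  refine Reaches.seq (m := 4) (P := fun τ => Inv 0 τ ∧ τ.int x 0 0 = 0 ∧
    Agrees (.forLoop x e c) σ τ) ?_ ?_ le_rfl
  · refine Reaches.setInt (by simp [IntExpr.cost]) ⟨hInv _ _ _ (hset _ _) hσ, ?_, ?_, ?_⟩
    · simp [State.setInt, IntExpr.eval]
    · intro a ha
      exact hset _ _ a (fun h => ha (h ▸ hmem))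
    · intro _
      rfl
  · rintro τ - ⟨hi, h0, hag⟩
    let J : State → Prop := fun τ => Agrees (.forLoop x e c) σ τ ∧ τ.int x 0 0 ≤ r ∧
      Inv (τ.int x 0 0) τ
    have key := Reaches.loop (σ := τ) (c := .seq c (.assign x (.add (.var x) (.const 1))))
      (t := .intLe (.add (.var x) (.const 1)) e) (Inv := J) (n := n + 8)
      (fun τ => r - τ.int x 0 0) ?_
      (show J τ from ⟨hag, by omega, by rw [h0]; exact hi⟩)
    · refine key.mono ?_ ?_
      · simp only [Test.cost, IntExpr.cost, IntExpr.var, h0, Nat.sub_zero]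
        have : 1 + 1 + 1 + 1 + 1 + e.cost + 1 = 6 + e.cost := by omega
        rw [this]
      · rintro ρ - ⟨⟨ha, hle, hI⟩, hn⟩
        have : ρ.int x 0 0 = r := by
          have := he ρ ha
          simp only [Test.Holds, IntExpr.eval, IntExpr.var] at hn
          omega
        exact this ▸ hI
    · rintro ρ - ⟨ha, hle, hI⟩ ht
      have her := he ρ ha
      simp only [Test.Holds, IntExpr.eval, IntExpr.var] at ht
      refine Reaches.seq (n := 8) (hstep _ ρ (by omega) ha rfl hI) ?_ le_rfl
      intro π hπ hIπ
      have hxπ : π.int x 0 0 = ρ.int x 0 0 := by rw [hπ.int_eq x hx]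
      refine Reaches.setInt (by simp [IntExpr.cost, IntExpr.var]) ?_
      have hval : (IntExpr.add (.var x) (.const 1)).eval π = ρ.int x 0 0 + 1 := by
        simp [IntExpr.eval, IntExpr.var, hxπ]
      rw [hval]
      simp only [IntExpr.eval]
      have hnew : (π.setInt x 0 0 (ρ.int x 0 0 + 1)).int x 0 0 = ρ.int x 0 0 + 1 := by
        simp [State.setInt]
      refine ⟨⟨ha.trans (hbody _ _ ⟨?_, ?_⟩), ?_, ?_⟩, ?_⟩
      · intro a ha'
        simp only [Program.targets, Program.assign, List.mem_append, List.mem_singleton,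
          not_or] at ha'
        rw [hset _ _ a ha'.2, hπ.int_eq a ha'.1]
      · intro hv
        simp only [Program.keepsVal, Program.assign, Bool.and_eq_true] at hv
        exact hπ.val_eq hv.1
      · omega
      · rw [hnew]
        exact hInv _ _ _ (hset _ _) hIπ
      · omega

end RealRAM

/-! ### Partial matchings, tight sets and the price bound -/

namespace ItemMatching

/-- Item `i` is served before item `j`: it has the larger value, or the same value and the smaller
index. -/
def Before (c : ℕ → ℝ≥0) (i j : ℕ) : Prop := c j < c i ∨ c i = c j ∧ i < j

theorem Before.le {c : ℕ → ℝ≥0} {i j : ℕ} (h : Before c i j) : c j ≤ c i :=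
  h.elim le_of_lt fun h => h.1.ge

theorem Before.asymm {c : ℕ → ℝ≥0} {i j : ℕ} (h : Before c i j) : ¬ Before c j i := by
  rintro (h' | ⟨h', hji⟩) <;> rcases h with h | ⟨h, hij⟩
  · exact lt_asymm h h'
  · exact h'.ne h
  · exact h.ne h'
  · exact lt_asymm hij hji

/-- The function `f` encodes a partial matching of the sellers `u < m` with the items `i < N`:
`f u = i + 1` if `u` is matched with `i`, and `f u = 0` if `u` is free. -/
structure IsMatching (m N : ℕ) (adj : ℕ → ℕ → Prop) (f : ℕ → ℕ) : Prop where
  adj_mate : ∀ u < m, ∀ i, f u = i + 1 → i < N ∧ adj i u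
  inj : ∀ u < m, ∀ w < m, f u = f w → f u ≠ 0 → u = w

/-- Item `i` is matched by `f`. -/
def Covers (m : ℕ) (f : ℕ → ℕ) (i : ℕ) : Prop := ∃ u < m, f u = i + 1

open Classical in
/-- The sellers adjacent to some item in `X`. -/
noncomputable def nbrs (m : ℕ) (adj : ℕ → ℕ → Prop) (X : Finset ℕ) : Finset ℕ :=
  (Finset.range m).filter fun u => ∃ i ∈ X, adj i u

variable {m N : ℕ} {adj : ℕ → ℕ → Prop} {c : ℕ → ℝ≥0} {f g d : ℕ → ℕ}

theorem mem_nbrs {X : Finset ℕ} {u : ℕ} : u ∈ nbrs m adj X ↔ u < m ∧ ∃ i ∈ X, adj i u := by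
  simp [nbrs]

/-- A reason for rejecting item `i`: a set of items that violates Hall's condition, whose members
other than `i` are matched by `f` and served before `i`. -/
def Obstructed (m : ℕ) (adj : ℕ → ℕ → Prop) (c : ℕ → ℝ≥0) (f : ℕ → ℕ) (i : ℕ) : Prop :=
  ∃ X : Finset ℕ, (∀ j ∈ X, j ≠ i → Covers m f j ∧ Before c j i) ∧
    (nbrs m adj X).card < X.card

theorem Obstructed.mono {i : ℕ} (h : Obstructed m adj c f i)
    (hfg : ∀ j, Covers m f j → Covers m g j) : Obstructed m adj c g i := by
  obtain ⟨X, hX, hc⟩ := h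
  exact ⟨X, fun j hj hji => ⟨hfg j (hX j hj hji).1, (hX j hj hji).2⟩, hc⟩

theorem IsMatching.exists_mate (hf : IsMatching m N adj f) {X : Finset ℕ}
    (hX : ∀ j ∈ X, Covers m f j) :
    ∃ w : ℕ → ℕ, (∀ j ∈ X, f (w j) = j + 1) ∧ (∀ j ∈ X, w j ∈ nbrs m adj X) ∧
      Set.InjOn w X := by
  choose! w hw hfw using hX
  refine ⟨w, hfw, fun j hj => mem_nbrs.2 ⟨hw j hj, j, hj, (hf.adj_mate _ (hw j hj) _ (hfw j hj)).2⟩,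
    fun j hj j' hj' h => ?_⟩
  have h1 := hfw j hj
  rw [h, hfw j' hj'] at h1
  omega

/-- The set of sellers `R` is tight at the item `i`: it contains the neighbours of `i`, and it is
filled by items that are served before `i` and have no neighbours outside `R`. -/
structure IsTightAt (m : ℕ) (adj : ℕ → ℕ → Prop) (c : ℕ → ℝ≥0) (f : ℕ → ℕ) (i : ℕ)
    (R : Finset ℕ) : Prop where
  nbr_mem : ∀ u < m, adj i u → u ∈ R
  exists_item : ∀ u ∈ R, ∃ j, f u = j + 1 ∧ Before c j i ∧ ∀ w < m, adj j w → w ∈ R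

theorem Obstructed.exists_tight (hf : IsMatching m N adj f) {i : ℕ}
    (h : Obstructed m adj c f i) : ∃ R, IsTightAt m adj c f i R := by
  obtain ⟨X, hX, hcard⟩ := h
  have hi : i ∈ X := by
    by_contra hi
    obtain ⟨w, -, hw, hinj⟩ := hf.exists_mate (X := X)
      fun j hj => (hX j hj (fun h => hi (h ▸ hj))).1
    have := Finset.card_le_card_of_injOn w hw hinj
    omega
  refine ⟨nbrs m adj X, fun u hu ha => mem_nbrs.2 ⟨hu, i, hi, ha⟩, fun u hu => ?_⟩
  have herase : ∀ j ∈ X.erase i, Covers m f j ∧ Before c j i := fun j hj =>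
    hX j (Finset.mem_of_mem_erase hj) (Finset.ne_of_mem_erase hj)
  obtain ⟨w, hfw, hw, hinj⟩ := hf.exists_mate (X := X.erase i) fun j hj => (herase j hj).1
  have hw' : ∀ j ∈ X.erase i, w j ∈ nbrs m adj X := by
    intro j hj
    obtain ⟨h1, k, hk, h2⟩ := mem_nbrs.1 (hw j hj)
    exact mem_nbrs.2 ⟨h1, k, Finset.mem_of_mem_erase hk, h2⟩
  -- the mates of the items of `X` other than `i` exhaust the neighbours of `X`
  obtain ⟨j, hj, hju⟩ := Finset.surjOn_of_injOn_of_card_le w hw' hinj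
    (by rw [Finset.card_erase_of_mem hi]; omega) hu
  have hj' : j ∈ X.erase i := hj
  refine ⟨j, hju ▸ hfw j hj', (herase j hj').2, fun v hv ha => ?_⟩
  exact mem_nbrs.2 ⟨hv, j, Finset.mem_of_mem_erase hj', ha⟩

/-- The outcome of the greedy algorithm: a matching together with a reason for each unmatched
item. -/
structure IsGreedy (m N : ℕ) (adj : ℕ → ℕ → Prop) (c : ℕ → ℝ≥0) (f : ℕ → ℕ) : Prop
    extends IsMatching m N adj f where
  obstructed : ∀ i < N, ¬ Covers m f i → Obstructed m adj c f i

theorem IsGreedy.exists_tight (hf : IsGreedy m N adj c f) :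
    ∃ R : ℕ → Finset ℕ, ∀ i < N, ¬ Covers m f i → IsTightAt m adj c f i (R i) := by
  have : ∀ i, ∃ R, i < N → ¬ Covers m f i → IsTightAt m adj c f i R := by
    intro i
    by_cases h : i < N ∧ ¬ Covers m f i
    · obtain ⟨R, hR⟩ := (hf.obstructed i h.1 h.2).exists_tight hf.toIsMatching
      exact ⟨R, fun _ _ => hR⟩
    · exact ⟨∅, fun h1 h2 => absurd ⟨h1, h2⟩ h⟩
  choose R hR using this
  exact ⟨R, hR⟩

/-- If the greedy matching fills all sellers, then it has the largest total value among the
assignments of distinct adjacent items to the sellers. The proof is by linear programming duality: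
the price of a seller is the largest value of a rejected item in whose tight set the seller lies. -/
theorem IsGreedy.sum_le (hf : IsGreedy m N adj c f) (hall : ∀ u < m, f u ≠ 0)
    {a : ℕ → ℕ} (haN : ∀ u < m, a u < N) (hadj : ∀ u < m, adj (a u) u)
    (hinj : Set.InjOn a (Finset.range m)) :
    ∑ u ∈ Finset.range m, c (a u) ≤ ∑ u ∈ Finset.range m, c (f u - 1) := by
  classical
  obtain ⟨R, hR⟩ := hf.exists_tight
  let price : ℕ → ℝ≥0 := fun u =>
    ((Finset.range N).filter fun i => ¬ Covers m f i ∧ u ∈ R i).sup c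
  let profit : ℕ → ℝ≥0 := fun i =>
    if h : Covers m f i then c i - price h.choose else 0
  have hprofit : ∀ u < m, ∀ i, f u = i + 1 → profit i = c i - price u := by
    intro u hu i hi
    have h : Covers m f i := ⟨u, hu, hi⟩
    have hch := h.choose_spec
    have : h.choose = u := hf.inj _ hch.1 _ hu (hch.2.trans hi.symm) (by omega)
    simp only [profit, dif_pos h, this]
  -- the price of a seller does not exceed the value of the item it gets
  have hprice_le : ∀ u < m, ∀ i, f u = i + 1 → price u ≤ c i := by
    intro u hu i hi
    refine Finset.sup_le fun k hk => ?_
    simp only [Finset.mem_filter, Finset.mem_range] at hk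
    obtain ⟨j, hj, hb, -⟩ := (hR k hk.1 hk.2.1).exists_item u hk.2.2
    obtain rfl : i = j := by omega
    exact hb.le
  -- dual feasibility: a tight set with the mate of `i` contains all neighbours of `i`
  have hedge : ∀ i < N, ∀ u < m, adj i u → c i ≤ price u + profit i := by
    intro i hi u hu ha
    by_cases hc : Covers m f i
    · obtain ⟨w, hw, hfw⟩ := hc
      have hle : price w ≤ price u := by
        refine Finset.sup_mono fun k hk => ?_
        simp only [Finset.mem_filter, Finset.mem_range] at hk ⊢
        obtain ⟨j, hj, -, hcl⟩ := (hR k hk.1 hk.2.1).exists_item w hk.2.2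
        obtain rfl : i = j := by omega
        exact ⟨hk.1, hk.2.1, hcl u hu ha⟩
      rw [hprofit w hw i hfw, ← add_tsub_cancel_of_le (hprice_le w hw i hfw)]
      simp only [add_tsub_cancel_left]
      gcongr
    · have : c i ≤ price u :=
        Finset.le_sup (f := c) (by
          simp only [Finset.mem_filter, Finset.mem_range]
          exact ⟨hi, hc, (hR i hi hc).nbr_mem u hu ha⟩)
      exact this.trans le_self_add
  have hfN : ∀ u < m, f u - 1 < N ∧ f u = f u - 1 + 1 := by
    intro u hu
    have h := hall u hu
    have h' : f u = f u - 1 + 1 := by omega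
    exact ⟨(hf.adj_mate u hu _ h').1, h'⟩
  calc ∑ u ∈ Finset.range m, c (a u)
      ≤ ∑ u ∈ Finset.range m, (price u + profit (a u)) := by
        refine Finset.sum_le_sum fun u hu => ?_
        rw [Finset.mem_range] at hu
        exact hedge _ (haN u hu) u hu (hadj u hu)
    _ = ∑ u ∈ Finset.range m, price u + ∑ i ∈ (Finset.range m).image a, profit i := by
        rw [Finset.sum_add_distrib, Finset.sum_image hinj]
    _ ≤ ∑ u ∈ Finset.range m, price u +
          ∑ i ∈ (Finset.range m).image fun u => f u - 1, profit i := by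
        refine add_le_add le_rfl (Finset.sum_le_sum_of_ne_zero fun i _ hi => ?_)
        by_cases hc : Covers m f i
        · obtain ⟨u, hu, hfu⟩ := hc
          exact Finset.mem_image.2 ⟨u, Finset.mem_range.2 hu, by omega⟩
        · simp [profit, hc] at hi
    _ = ∑ u ∈ Finset.range m, (price u + profit (f u - 1)) := by
        rw [Finset.sum_image, Finset.sum_add_distrib]
        intro u hu w hw h
        simp only [Finset.coe_range, Set.mem_Iio] at hu hw
        have h1 := hfN u hu
        have h2 := hfN w hw
        have h3 : f u - 1 = f w - 1 := h
        exact hf.inj u hu w hw (by omega) (hall u hu)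
    _ = ∑ u ∈ Finset.range m, c (f u - 1) := by
        refine Finset.sum_congr rfl fun u hu => ?_
        rw [Finset.mem_range] at hu
        rw [hprofit u hu _ (hfN u hu).2,
          add_tsub_cancel_of_le (hprice_le u hu _ (hfN u hu).2)]

/-! ### Extending a matching by an auction with integer prices -/

/-- The state of an auction that tries to add the item `k` to the matching `f`. The function `g` is
the current matching, `d u` is the current price of the seller `u`, and `x` is the item looking for
a seller plus one, or zero if there is none. Every matched item sits at a seller whose price
exceeds that of no other neighbour by more than one. -/
structure IsAuction (m N : ℕ) (adj : ℕ → ℕ → Prop) (f : ℕ → ℕ) (k : ℕ) (g d : ℕ → ℕ) (x : ℕ) :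
    Prop extends IsMatching m N adj g where
  covers_iff : ∀ j, (Covers m g j ∨ x = j + 1) ↔ (Covers m f j ∨ j = k)
  not_covers : x ≠ 0 → ∀ u < m, g u ≠ x
  price_le : ∀ u < m, d u ≤ m
  matched : ∀ u < m, d u ≠ 0 → g u ≠ 0
  slack : ∀ u < m, ∀ i, g u = i + 1 → ∀ w < m, adj i w → d u ≤ d w + 1

theorem IsMatching.isAuction (hf : IsMatching m N adj f) {k : ℕ} (hk : ¬ Covers m f k)
    (hg : ∀ u < m, g u = f u) (hd : ∀ u < m, d u = 0) :
    IsAuction m N adj f k g d (k + 1) where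
  adj_mate u hu i hi := hf.adj_mate u hu i (hg u hu ▸ hi)
  inj u hu w hw := by
    rw [hg u hu, hg w hw]
    exact hf.inj u hu w hw
  covers_iff j := by
    have : Covers m g j ↔ Covers m f j := by
      constructor <;> rintro ⟨u, hu, h⟩ <;> refine ⟨u, hu, ?_⟩ <;> simpa [hg u hu] using h
    rw [this]
    constructor <;> rintro (h | h) <;> first | exact .inl h | exact .inr (by omega)
  not_covers _ u hu h := hk ⟨u, hu, by rw [← hg u hu, h]⟩
  price_le u hu := by simp [hd u hu]
  matched u hu h := absurd (hd u hu) h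
  slack u hu i _ w _ _ := by simp [hd u hu]

/-- One bid: the item `i` takes the cheapest neighbouring seller `b` and raises its price by one;
the item previously at `b`, if any, is next to look for a seller. -/
theorem IsAuction.bid {k i b : ℕ} (h : IsAuction m N adj f k g d (i + 1)) (hi : i < N) (hb : b < m)
    (hadj : adj i b) (hmin : ∀ u < m, adj i u → d b ≤ d u) (hlt : d b < m) :
    IsAuction m N adj f k (Function.update g b (i + 1)) (Function.update d b (d b + 1)) (g b) where
  adj_mate u hu j hj := by
    by_cases hub : u = b
    · subst hub
      simp only [Function.update_self, Nat.add_right_cancel_iff] at hj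
      exact hj ▸ ⟨hi, hadj⟩
    · rw [Function.update_of_ne hub] at hj
      exact h.adj_mate u hu j hj
  inj u hu w hw := by
    have hn := h.not_covers (by omega)
    by_cases hub : u = b <;> by_cases hwb : w = b
    · intros; omega
    · subst hub
      rw [Function.update_self, Function.update_of_ne hwb]
      intro h'
      exact absurd h'.symm (hn w hw)
    · subst hwb
      rw [Function.update_self, Function.update_of_ne hub]
      intro h'
      exact absurd h' (hn u hu)
    · rw [Function.update_of_ne hub, Function.update_of_ne hwb]
      exact h.inj u hu w hw
  covers_iff j := by
    rw [← h.covers_iff j]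
    constructor
    · rintro (⟨u, hu, hj⟩ | hj)
      · by_cases hub : u = b
        · subst hub
          rw [Function.update_self] at hj
          exact .inr hj
        · rw [Function.update_of_ne hub] at hj
          exact .inl ⟨u, hu, hj⟩
      · exact .inl ⟨b, hb, hj⟩
    · rintro (⟨u, hu, hj⟩ | hj)
      · by_cases hub : u = b
        · exact .inr (hub ▸ hj)
        · exact .inl ⟨u, hu, by rw [Function.update_of_ne hub, hj]⟩
      · exact .inl ⟨b, hb, by rw [Function.update_self, hj]⟩
  not_covers h0 u hu := by
    by_cases hub : u = b
    · subst hub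
      rw [Function.update_self]
      exact (h.not_covers (by omega) u hu).symm
    · rw [Function.update_of_ne hub]
      intro hub'
      exact hub (h.inj u hu b hb hub' (hub' ▸ h0))
  price_le u hu := by
    by_cases hub : u = b
    · subst hub
      rw [Function.update_self]
      omega
    · rw [Function.update_of_ne hub]
      exact h.price_le u hu
  matched u hu := by
    by_cases hub : u = b
    · subst hub
      simp
    · rw [Function.update_of_ne hub, Function.update_of_ne hub]
      exact h.matched u hu
  slack u hu j hj w hw ha := by
    have hmono : d w ≤ Function.update d b (d b + 1) w := by
      by_cases hwb : w = b
      · subst hwb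
        simp
      · rw [Function.update_of_ne hwb]
    refine le_trans ?_ (Nat.add_le_add_right hmono 1)
    by_cases hub : u = b
    · subst hub
      simp only [Function.update_self, Nat.add_right_cancel_iff] at hj ⊢
      exact Nat.add_le_add_right (hmin w hw (hj ▸ ha)) 1
    · rw [Function.update_of_ne hub] at hj ⊢
      exact h.slack u hu j hj w hw ha

/-- If an item sees only prices of at least `m`, then Hall's condition fails: some price `l ≤ m` is
not taken by any of the `m` sellers, and the items at the sellers dearer than `l`, together with
the item looking for a seller, have no neighbours but those sellers. -/
theorem IsAuction.exists_violator {k i : ℕ} (h : IsAuction m N adj f k g d (i + 1))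
    (hhigh : ∀ u < m, adj i u → m ≤ d u) :
    ∃ X : Finset ℕ, (∀ j ∈ X, Covers m f j ∨ j = k) ∧ (nbrs m adj X).card < X.card := by
  classical
  obtain ⟨l, hl, hgap⟩ : ∃ l ≤ m, ∀ u < m, d u ≠ l := by
    by_contra! hcon
    have hsub : Finset.range (m + 1) ⊆ (Finset.range m).image d := by
      intro l hl
      obtain ⟨u, hu, hdu⟩ := hcon l (Nat.lt_succ_iff.1 (Finset.mem_range.1 hl))
      exact Finset.mem_image.2 ⟨u, Finset.mem_range.2 hu, hdu⟩
    have h1 := Finset.card_le_card hsub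
    have h2 := Finset.card_image_le (s := Finset.range m) (f := d)
    simp only [Finset.card_range] at h1 h2
    omega
  let R := (Finset.range m).filter fun u => l < d u
  have hR : ∀ u ∈ R, u < m ∧ l < d u ∧ g u = g u - 1 + 1 := by
    intro u hu
    simp only [R, Finset.mem_filter, Finset.mem_range] at hu
    have := h.matched u hu.1 (by omega)
    exact ⟨hu.1, hu.2, by omega⟩
  have hi : i ∉ R.image fun u => g u - 1 := by
    intro hi
    obtain ⟨u, hu, hgu⟩ := Finset.mem_image.1 hi
    have hu' := hR u hu
    exact h.not_covers (by omega) u hu'.1 (by omega)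
  refine ⟨insert i (R.image fun u => g u - 1), ?_, ?_⟩
  · intro j hj
    rw [← h.covers_iff j]
    rcases Finset.mem_insert.1 hj with rfl | hj
    · exact .inr rfl
    · obtain ⟨u, hu, hgu⟩ := Finset.mem_image.1 hj
      have hu' := hR u hu
      exact .inl ⟨u, hu'.1, by omega⟩
  · rw [Finset.card_insert_of_notMem hi, Finset.card_image_of_injOn, Nat.lt_succ_iff]
    · refine Finset.card_le_card fun w hw => ?_
      obtain ⟨hwm, j, hj, ha⟩ := mem_nbrs.1 hw
      have hne := hgap w hwm
      have : l ≤ d w := by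
        rcases Finset.mem_insert.1 hj with rfl | hj
        · exact hl.trans (hhigh w hwm ha)
        · obtain ⟨u, hu, rfl⟩ := Finset.mem_image.1 hj
          have hu' := hR u hu
          have := h.slack u hu'.1 _ hu'.2.2 w hwm ha
          omega
      simp only [R, Finset.mem_filter, Finset.mem_range]
      exact ⟨hwm, by omega⟩
    · intro u hu w hw huw
      have hu' := hR u hu
      have hw' := hR w hw
      have : g u - 1 = g w - 1 := huw
      exact h.inj u hu'.1 w hw'.1 (by omega) (by omega)

/-! ### The greedy algorithm -/

/-- The state of the greedy algorithm after `t` items have been considered, those with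
`done i ≠ 0`. -/
structure IsGreedyStage (m N : ℕ) (adj : ℕ → ℕ → Prop) (c : ℕ → ℝ≥0) (done f : ℕ → ℕ) (t : ℕ) :
    Prop extends IsMatching m N adj f where
  done_of_covers : ∀ i, Covers m f i → done i ≠ 0
  before : ∀ i < N, ∀ j < N, done i ≠ 0 → done j = 0 → Before c i j
  card_done : ((Finset.range N).filter fun i => done i ≠ 0).card = t
  obstructed : ∀ i < N, done i ≠ 0 → ¬ Covers m f i → Obstructed m adj c f i

variable {done done' : ℕ → ℕ}

theorem isGreedyStage_zero (hf : ∀ u, f u = 0) (hdone : ∀ i, done i = 0) :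
    IsGreedyStage m N adj c done f 0 where
  adj_mate u _ i h := by simp [hf] at h
  inj u _ w _ _ h := absurd (hf u) h
  done_of_covers i := by
    rintro ⟨u, -, h⟩
    simp [hf] at h
  before i _ _ _ h := absurd (hdone i) h
  card_done := by simp [hdone]
  obstructed i _ h := absurd (hdone i) h

theorem IsGreedyStage.exists_not_done {t : ℕ} (h : IsGreedyStage m N adj c done f t) (ht : t < N) :
    ∃ i < N, done i = 0 := by
  by_contra! hcon
  have := h.card_done
  rw [Finset.filter_true_of_mem fun i hi => hcon i (Finset.mem_range.1 hi), Finset.card_range]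
    at this
  omega

theorem IsGreedyStage.isGreedy (h : IsGreedyStage m N adj c done f N) : IsGreedy m N adj c f where
  toIsMatching := h.toIsMatching
  obstructed i hi hc := by
    refine h.obstructed i hi (fun h0 => ?_) hc
    have hlt : ((Finset.range N).filter fun i => done i ≠ 0).card < (Finset.range N).card :=
      Finset.card_lt_card (Finset.filter_ssubset.2 ⟨i, Finset.mem_range.2 hi, by simpa using h0⟩)
    rw [h.card_done, Finset.card_range] at hlt
    exact lt_irrefl _ hlt

/-- Considering the first remaining item `k` leads to the next stage, if `k` is added to the
matching or is rejected because of a violation of Hall's condition. -/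
theorem IsGreedyStage.succ {t k : ℕ} (h : IsGreedyStage m N adj c done f t) (hk : k < N)
    (hdk : done k = 0) (hfirst : ∀ j < N, done j = 0 → j ≠ k → Before c k j)
    (hdone' : done' = Function.update done k 1) (hg : IsMatching m N adj g)
    (hcase : (∀ j, Covers m g j ↔ Covers m f j ∨ j = k) ∨
      (∀ j, Covers m g j ↔ Covers m f j) ∧
        ∃ X : Finset ℕ, (∀ j ∈ X, Covers m f j ∨ j = k) ∧ (nbrs m adj X).card < X.card) :
    IsGreedyStage m N adj c done' g (t + 1) := by
  have hdone : ∀ j, done' j ≠ 0 ↔ done j ≠ 0 ∨ j = k := by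
    intro j
    rw [hdone']
    by_cases hjk : j = k
    · simp [hjk]
    · simp [hjk]
  have hmono : ∀ j, Covers m f j → Covers m g j := by
    intro j hj
    rcases hcase with hc | hc
    · exact (hc j).2 (.inl hj)
    · exact (hc.1 j).2 hj
  refine ⟨hg, ?_, ?_, ?_, ?_⟩
  · intro i hi
    rw [hdone]
    rcases hcase with hc | hc
    · exact ((hc i).1 hi).imp (h.done_of_covers i) id
    · exact .inl (h.done_of_covers i ((hc.1 i).1 hi))
  · intro i hi j hj hdi hdj
    have hj' : done j = 0 ∧ j ≠ k := by simpa using mt (hdone j).2 (not_not.2 hdj)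
    rcases (hdone i).1 hdi with hdi | rfl
    · exact h.before i hi j hj hdi hj'.1
    · exact hfirst j hj hj'.1 hj'.2
  · have : (Finset.range N).filter (fun i => done' i ≠ 0) =
        insert k ((Finset.range N).filter fun i => done i ≠ 0) := by
      ext i
      simp only [Finset.mem_filter, Finset.mem_range, Finset.mem_insert, hdone]
      constructor
      · rintro ⟨h1, h2 | h2⟩
        · exact .inr ⟨h1, h2⟩
        · exact .inl h2
      · rintro (rfl | ⟨h1, h2⟩)
        · exact ⟨hk, .inr rfl⟩
        · exact ⟨h1, .inl h2⟩
    rw [this, Finset.card_insert_of_notMem (by simp [hdk]), h.card_done]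
  · intro i hi hdi hc
    rcases (hdone i).1 hdi with hdi | rfl
    · exact (h.obstructed i hi hdi fun h' => hc (hmono i h')).mono hmono
    · rcases hcase with hc' | ⟨-, X, hX, hcard⟩
      · exact absurd ((hc' i).2 (.inr rfl)) hc
      · refine ⟨X, fun j hj hji => ?_, hcard⟩
        have hcj := (hX j hj).resolve_right hji
        obtain ⟨u, hu, hfu⟩ := hcj
        exact ⟨hmono j ⟨u, hu, hfu⟩, h.before j (h.adj_mate u hu j hfu).1 i hi
          (h.done_of_covers j ⟨u, hu, hfu⟩) hdk⟩

end ItemMatching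

/-! ### The program -/

namespace RealRAM

/-- The number of sellers, in the cell `0[0, 0]`. -/
def sellerCount : IntExpr := .var 0

/-- The number of items. -/
def itemCount : IntExpr := .add (.var 0) (.read 0 (.const 0) (.const 1))

/-- The test whether the item `i` is adjacent to the seller `u`. With `m` sellers, an item `i < m`
is adjacent to the seller `m - 1 - i` only, and an item `m + l` is adjacent to the sellers that are
compatible with the `l`-th buyer unit. -/
def adjTest (i u : IntExpr) : Test :=
  .not (.and
    (.not (.and (.intLe (.add (.add i u) (.const 1)) sellerCount)
      (.intLe sellerCount (.add (.add i u) (.const 1)))))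
    (.not (.and (.intLe sellerCount i)
      (.intLe (.const 1) (.read 3 (.entry 1 u) (.entry 2 (.sub i sellerCount)))))))

/-- The value of the item `i`. With `m` sellers, this is `0[0, m - 1 - i]` for `i < m` and
`0[1, i - m]` for `m ≤ i`; subtraction is truncated, which makes one expression serve both cases. -/
def itemVal (i : IntExpr) : ValExpr :=
  .read 0 (.sub (.const 1) (.sub sellerCount i))
    (.add (.sub (.sub sellerCount (.const 1)) i) (.sub i sellerCount))

/-- Set the variable `9` to `k + 1`, where `k` is the first of the remaining items: those with
entry `0` in the array `5`. -/
def selectItem : Program :=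
  .seq (.assign 9 (.const 0))
    (.forLoop 15 itemCount
      (.ite (.and (.intLe (.entry 5 (.var 15)) (.const 0))
          (.not (.and (.intLe (.const 1) (.var 9))
            (.valLe (itemVal (.var 15)) (itemVal (.sub (.var 9) (.const 1)))))))
        (.assign 9 (.add (.var 15) (.const 1)))
        .skip))

/-- Set the variable `12` to a cheapest seller adjacent to the item in the variable `10`, and the
variable `11` to its price; but set the latter to the number of sellers if no price is below it.
The prices are in the array `8`. -/
def findCheapest : Program :=
  .seq (.assign 11 sellerCount)
    (.forLoop 16 sellerCount
      (.ite (.and (adjTest (.sub (.var 10) (.const 1)) (.var 16))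
          (.intLe (.add (.entry 8 (.var 16)) (.const 1)) (.var 11)))
        (.seq (.assign 11 (.entry 8 (.var 16))) (.assign 12 (.var 16)))
        .skip))

/-- Place the item in the variable `10` at the cheapest seller, raise the price of that seller, and
leave the displaced item in the variable `10`. The array `7` holds the tentative matching. -/
def placeBid : Program :=
  .seq (.assign 13 (.entry 7 (.var 12)))
    (.seq (.store 7 (.var 12) (.var 10))
      (.seq (.store 8 (.var 12) (.add (.var 11) (.const 1)))
        (.assign 10 (.var 13))))

/-- One bid of the auction. -/
def bidStep : Program :=
  .seq findCheapest
    (.ite (.intLe (.add (.var 11) (.const 1)) sellerCount) placeBid .skip)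

/-- The auction goes on while there is an item looking for a seller, and prices below the number of
sellers have been met. -/
def auctionLoop : Program :=
  .loop (.and (.intLe (.const 1) (.var 10)) (.intLe (.add (.var 11) (.const 1)) sellerCount))
    bidStep

/-- Start the auction: copy the matching, reset the prices, and let the selected item bid. -/
def startAuction : Program :=
  .seq
    (.forLoop 16 sellerCount
      (.seq (.store 7 (.var 16) (.entry 6 (.var 16))) (.store 8 (.var 16) (.const 0))))
    (.seq (.assign 10 (.var 9)) (.assign 11 (.const 0)))

/-- Adopt the tentative matching if no item is left looking for a seller. -/
def commit : Program :=
  .ite (.intLe (.var 10) (.const 0))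
    (.forLoop 16 sellerCount (.store 6 (.var 16) (.entry 7 (.var 16))))
    .skip

/-- Consider the first remaining item. -/
def considerItem : Program :=
  .seq selectItem
    (.seq (.store 5 (.sub (.var 9) (.const 1)) (.const 1))
      (.seq startAuction (.seq auctionLoop commit)))

/-- Write the output. An item below the number of sellers becomes the entry `0`. -/
def writeOutput : Program :=
  .forLoop 16 sellerCount (.store 4 (.var 16) (.sub (.entry 6 (.var 16)) sellerCount))

/-- The greedy algorithm. The array `5` marks the items already considered, and the array `6`
holds the matching. -/
def greedyProgram : Program :=
  .seq (.forLoop 14 itemCount considerItem) writeOutput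

/-! ### Correctness of the program -/

open ItemMatching

/-- The memory `σ` holds, in the format of the input, a matching problem with `m` sellers, `N`
items, adjacency relation `adj` and item values `c`. -/
structure Represents (σ : State) (m N : ℕ) (adj : ℕ → ℕ → Prop) (c : ℕ → ℝ≥0) : Prop where
  sellers : σ.int 0 0 0 = m
  items : σ.int 0 0 0 + σ.int 0 0 1 = N
  adj_iff : ∀ i < N, ∀ u < m, adj i u ↔
    i + u + 1 = m ∨ m ≤ i ∧ 1 ≤ σ.int 3 (σ.int 1 u 0) (σ.int 2 (i - m) 0)
  val_eq : ∀ i < N, σ.val 0 (1 - (m - i)) (m - 1 - i + (i - m)) = c i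

variable {σ τ : State} {m N : ℕ} {adj : ℕ → ℕ → Prop} {c : ℕ → ℝ≥0}

theorem Represents.congr (h : Represents σ m N adj c) (h0 : τ.int 0 = σ.int 0)
    (h1 : τ.int 1 = σ.int 1) (h2 : τ.int 2 = σ.int 2) (h3 : τ.int 3 = σ.int 3)
    (hv : τ.val = σ.val) : Represents τ m N adj c where
  sellers := by rw [h0, h.sellers]
  items := by rw [h0, h.items]
  adj_iff := by rw [h1, h2, h3]; exact h.adj_iff
  val_eq := by rw [hv]; exact h.val_eq

theorem Represents.agrees {p : Program} (h : Represents σ m N adj c) (ha : Agrees p σ τ)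
    (hp : (∀ a ∈ p.targets, 4 ≤ a) ∧ p.keepsVal = true) : Represents τ m N adj c := by
  have : ∀ a < 4, τ.int a = σ.int a := fun a ha4 =>
    ha.int_eq a fun hmem => absurd (hp.1 a hmem) (not_le.2 ha4)
  exact h.congr (this 0 (by omega)) (this 1 (by omega)) (this 2 (by omega)) (this 3 (by omega))
    (ha.val_eq hp.2)

theorem Represents.eval_sellerCount (h : Represents σ m N adj c) : sellerCount.eval σ = m :=
  h.sellers

theorem Represents.eval_itemCount (h : Represents σ m N adj c) : itemCount.eval σ = N :=
  h.items

theorem Represents.holds_adjTest (h : Represents σ m N adj c) {i u : IntExpr}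
    (hi : i.eval σ < N) (hu : u.eval σ < m) :
    (adjTest i u).Holds σ ↔ adj (i.eval σ) (u.eval σ) := by
  rw [h.adj_iff _ hi _ hu]
  simp only [adjTest, Test.Holds, IntExpr.eval, h.eval_sellerCount, IntExpr.entry]
  rw [not_and_or, not_not, not_not, ← le_antisymm_iff]

theorem Represents.eval_itemVal (h : Represents σ m N adj c) {i : IntExpr} (hi : i.eval σ < N) :
    (itemVal i).eval σ = c (i.eval σ) := by
  rw [← h.val_eq _ hi]
  simp only [itemVal, ValExpr.eval, IntExpr.eval, h.eval_sellerCount]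

theorem State.setInt_int_of_ne {a a' i j n : ℕ} (h : a' ≠ a) :
    (σ.setInt a i j n).int a' = σ.int a' := by
  funext i j
  simp [State.setInt, h]

theorem Represents.reaches_selectItem (h : Represents σ m N adj c)
    (hex : ∃ i < N, σ.int 5 i 0 = 0) :
    Reaches selectItem σ (200 * N + 200) fun τ => ∃ k < N, τ.int 9 0 0 = k + 1 ∧
      σ.int 5 k 0 = 0 ∧ ∀ j < N, σ.int 5 j 0 = 0 → j ≠ k → Before c k j := by
  let Inv : ℕ → State → Prop := fun i τ =>
    (τ.int 9 0 0 = 0 ∧ ∀ j < i, σ.int 5 j 0 ≠ 0) ∨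
    ∃ k < i, τ.int 9 0 0 = k + 1 ∧ σ.int 5 k 0 = 0 ∧
      ∀ j < i, σ.int 5 j 0 = 0 → j ≠ k → Before c k j
  refine Reaches.seq (m := 4) (n := 200 * N + 196) (P := Inv 0) ?_ ?_ (by omega)
  · exact Reaches.setInt (by simp [IntExpr.cost]) (.inl ⟨by simp [State.setInt, IntExpr.eval],
      by simp⟩)
  intro τ hτ hinv
  have hτrep := h.agrees hτ (by decide)
  have hτ5 : τ.int 5 = σ.int 5 := hτ.int_eq 5 (by decide)
  refine (Reaches.forLoop (n := 150) N (Inv := Inv) (by decide) ?_ ?_ hinv ?_).mono ?_ ?_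
  · intro ρ hρ
    exact (hτrep.agrees hρ (by decide)).eval_itemCount
  · intro i ρ π hπ hi
    simpa only [Inv, hπ 9 (by decide)] using hi
  · intro i ρ hi hρ hx hI
    have hrep := hτrep.agrees hρ (by decide)
    have hρ5 : ρ.int 5 = σ.int 5 := (hρ.int_eq 5 (by decide)).trans hτ5
    have hei : (IntExpr.var 15).eval ρ = i := hx
    refine Reaches.ite (n := 10) ?_ ?_ (by decide)
    · intro ht
      refine Reaches.setInt (by decide) ?_
      have h9 : (ρ.setInt 9 0 0 (i + 1)).int 9 0 0 = i + 1 := by simp [State.setInt]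
      simp only [IntExpr.eval, hei]
      simp only [Test.Holds, IntExpr.entry, IntExpr.eval, hei, hρ5, Nat.le_zero] at ht
      refine .inr ⟨i, by omega, h9, ht.1, fun j hj hj0 hji => ?_⟩
      have hj' : j < i := by omega
      rcases hI with ⟨-, hI⟩ | ⟨k, hk, h9k, hk0, hI⟩
      · exact absurd hj0 (hI j hj')
      · have hlt : c k < c i := by
          have ht2 := ht.2
          have hek : (IntExpr.sub (.var 9) (.const 1)).eval ρ = k := by
            simp [IntExpr.eval, IntExpr.var, h9k]
          rw [hrep.eval_itemVal (by rw [hei]; exact hi), hrep.eval_itemVal (by rw [hek]; omega),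
            hei, hek] at ht2
          by_contra hcon
          refine ht2 ⟨?_, by exact_mod_cast not_lt.1 hcon⟩
          simp [IntExpr.eval, IntExpr.var, h9k]
        by_cases hjk : j = k
        · exact .inl (hjk ▸ hlt)
        · exact .inl ((hI j hj' hj0 hjk).le.trans_lt hlt)
    · intro ht
      refine Reaches.skip (by omega) ?_
      simp only [Test.Holds, IntExpr.entry, IntExpr.eval, hei, hρ5, Nat.le_zero] at ht
      rcases hI with ⟨h9, hI⟩ | ⟨k, hk, h9k, hk0, hI⟩
      · refine .inl ⟨h9, fun j hj hj0 => ?_⟩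
        rcases Nat.lt_succ_iff_lt_or_eq.1 hj with hj | rfl
        · exact hI j hj hj0
        · exact ht ⟨hj0, fun hcon => by simp [IntExpr.var, IntExpr.eval, h9] at hcon⟩
      · refine .inr ⟨k, by omega, h9k, hk0, fun j hj hj0 hjk => ?_⟩
        rcases Nat.lt_succ_iff_lt_or_eq.1 hj with hj | rfl
        · exact hI j hj hj0 hjk
        · have hle : c j ≤ c k := by
            by_contra hcon
            refine ht ⟨hj0, fun hcon' => hcon ?_⟩
            have hek : (IntExpr.sub (.var 9) (.const 1)).eval ρ = k := by
              simp [IntExpr.eval, IntExpr.var, h9k]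
            have := hcon'.2
            rw [hrep.eval_itemVal (by rw [hei]; exact hi),
              hrep.eval_itemVal (by rw [hek]; omega), hei, hek] at this
            exact_mod_cast this
          rcases hle.lt_or_eq with hlt | heq
          · exact .inl hlt
          · exact .inr ⟨heq.symm, hk⟩
  · simp only [itemCount, IntExpr.cost, IntExpr.var]
    omega
  · intro ρ hρ hI
    rcases hI with ⟨-, hI⟩ | hI
    · obtain ⟨i, hi, h0⟩ := hex
      exact absurd h0 (hI i hi)
    · exact hI

theorem Represents.reaches_findCheapest (h : Represents σ m N adj c) {i : ℕ} (hi : i < N)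
    (hbid : σ.int 10 0 0 = i + 1) :
    Reaches findCheapest σ (200 * m + 100) fun τ =>
      (τ.int 11 0 0 = m ∧ ∀ u < m, adj i u → m ≤ σ.int 8 u 0) ∨
      ∃ b < m, τ.int 12 0 0 = b ∧ adj i b ∧ τ.int 11 0 0 = σ.int 8 b 0 ∧ σ.int 8 b 0 < m ∧
        ∀ u < m, adj i u → σ.int 8 b 0 ≤ σ.int 8 u 0 := by
  let Inv : ℕ → State → Prop := fun n τ =>
      (τ.int 11 0 0 = m ∧ ∀ u < n, adj i u → m ≤ σ.int 8 u 0) ∨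
      ∃ b < n, τ.int 12 0 0 = b ∧ adj i b ∧ τ.int 11 0 0 = σ.int 8 b 0 ∧ σ.int 8 b 0 < m ∧
        ∀ u < n, adj i u → σ.int 8 b 0 ≤ σ.int 8 u 0
  refine Reaches.seq (m := 6) (n := 200 * m + 90) (P := Inv 0) ?_ ?_ (by omega)
  · exact Reaches.setInt (by decide) (.inl ⟨by simp [State.setInt, IntExpr.eval,
      h.eval_sellerCount], by simp⟩)
  intro τ hτ hinv
  have hτrep := h.agrees hτ (by decide)
  have hτ8 : τ.int 8 = σ.int 8 := hτ.int_eq 8 (by decide)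
  have hτ10 : τ.int 10 = σ.int 10 := hτ.int_eq 10 (by decide)
  refine (Reaches.forLoop (n := 150) m (Inv := Inv) (by decide) ?_ ?_ hinv ?_).mono ?_ ?_
  · intro ρ hρ
    exact (hτrep.agrees hρ (by decide)).eval_sellerCount
  · intro i ρ π hπ hi
    simpa only [Inv, hπ 11 (by decide), hπ 12 (by decide)] using hi
  · intro u ρ hu hρ hx hI
    have hrep := hτrep.agrees hρ (by decide)
    have hρ8 : ρ.int 8 = σ.int 8 := (hρ.int_eq 8 (by decide)).trans hτ8
    have hρ10 : ρ.int 10 = σ.int 10 := (hρ.int_eq 10 (by decide)).trans hτ10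
    have heu : (IntExpr.var 16).eval ρ = u := hx
    have hei : (IntExpr.sub (.var 10) (.const 1)).eval ρ = i := by
      simp [IntExpr.eval, IntExpr.var, hρ10, hbid]
    have htest := hrep.holds_adjTest (i := .sub (.var 10) (.const 1)) (u := .var 16)
      (by rw [hei]; exact hi) (by rw [heu]; exact hu)
    rw [hei, heu] at htest
    have hele : (IntExpr.add (.entry 8 (.var 16)) (.const 1)).eval ρ ≤ (IntExpr.var 11).eval ρ ↔
        σ.int 8 u 0 < ρ.int 11 0 0 := by
      simp only [IntExpr.eval, IntExpr.entry, IntExpr.var, hx, hρ8, Nat.succ_le_iff]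
    refine Reaches.ite (n := 20) ?_ ?_ (by decide)
    · intro ht
      simp only [Test.Holds] at ht
      rw [htest, hele] at ht
      refine Reaches.seq (m := 10) (n := 10) (P := fun π => π = ρ.setInt 11 0 0 (σ.int 8 u 0))
        (Reaches.setInt (by decide) ?_) ?_ le_rfl
      · simp only [IntExpr.eval, IntExpr.entry, heu, hρ8]
      rintro π - rfl
      refine Reaches.setInt (by decide) ?_
      simp only [IntExpr.eval, IntExpr.var]
      have h16 : (ρ.setInt 11 0 0 (σ.int 8 u 0)).int 16 0 0 = u := by
        rw [State.setInt_int_of_ne (by decide), hx]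
      rw [h16]
      refine .inr ⟨u, by omega, by simp [State.setInt], ht.1, by simp [State.setInt], ?_, ?_⟩
      · rcases hI with ⟨h11, -⟩ | ⟨b, hb, -, -, h11, hlt, -⟩ <;> omega
      · intro w hw ha
        rcases Nat.lt_succ_iff_lt_or_eq.1 hw with hw | rfl
        · rcases hI with ⟨h11, hI⟩ | ⟨b, hb, -, -, h11, hlt, hI⟩
          · have := hI w hw ha
            omega
          · have := hI w hw ha
            omega
        · exact le_rfl
    · intro ht
      simp only [Test.Holds] at ht
      rw [htest, hele] at ht
      refine Reaches.skip (by omega) ?_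
      rcases hI with ⟨h11, hI⟩ | ⟨b, hb, h12, hab, h11, hlt, hI⟩
      · refine .inl ⟨h11, fun w hw ha => ?_⟩
        rcases Nat.lt_succ_iff_lt_or_eq.1 hw with hw | rfl
        · exact hI w hw ha
        · by_contra hcon
          exact ht ⟨ha, by omega⟩
      · refine .inr ⟨b, by omega, h12, hab, h11, hlt, fun w hw ha => ?_⟩
        rcases Nat.lt_succ_iff_lt_or_eq.1 hw with hw | rfl
        · exact hI w hw ha
        · by_contra hcon
          exact ht ⟨ha, by omega⟩
  · simp only [sellerCount, IntExpr.cost, IntExpr.var]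
    omega
  · intro ρ hρ hI
    exact hI

/-- The effect of `placeBid` on the tentative matching, the prices and the bidding item. -/
theorem reaches_placeBid {b : ℕ} (hb : σ.int 12 0 0 = b) :
    Reaches placeBid σ 40 fun τ =>
      (fun u => τ.int 7 u 0) = Function.update (fun u => σ.int 7 u 0) b (σ.int 10 0 0) ∧
      (fun u => τ.int 8 u 0) = Function.update (fun u => σ.int 8 u 0) b (σ.int 11 0 0 + 1) ∧
      τ.int 10 0 0 = σ.int 7 b 0 := by
  refine Reaches.seq (m := 10) (n := 30) (P := fun π => π = σ.setInt 13 0 0 (σ.int 7 b 0))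
    (Reaches.setInt (by decide) (by simp [IntExpr.eval, IntExpr.entry, IntExpr.var, hb])) ?_ le_rfl
  rintro π - rfl
  refine Reaches.seq (m := 10) (n := 20)
    (P := fun π => π = (σ.setInt 13 0 0 (σ.int 7 b 0)).setInt 7 b 0 (σ.int 10 0 0))
    (Reaches.setInt (by decide) (by simp [IntExpr.eval, IntExpr.var, State.setInt, hb])) ?_ le_rfl
  rintro π - rfl
  refine Reaches.seq (m := 10) (n := 10)
    (P := fun π => π = ((σ.setInt 13 0 0 (σ.int 7 b 0)).setInt 7 b 0 (σ.int 10 0 0)).setInt 8 b 0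
      (σ.int 11 0 0 + 1))
    (Reaches.setInt (by decide) (by simp [IntExpr.eval, IntExpr.var, State.setInt, hb])) ?_ le_rfl
  rintro π - rfl
  refine Reaches.setInt (by decide) ⟨?_, ?_, ?_⟩
  · funext u
    simp [State.setInt, Function.update_apply]
  · funext u
    simp [State.setInt, Function.update_apply]
  · simp [State.setInt, IntExpr.eval, IntExpr.var]

theorem Represents.reaches_auctionLoop (h : Represents σ m N adj c) {f : ℕ → ℕ} {k : ℕ}
    (hf : IsMatching m N adj f) (hk : k < N)
    (hauc : IsAuction m N adj f k (fun u => σ.int 7 u 0) (fun u => σ.int 8 u 0) (σ.int 10 0 0))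
    (h11 : σ.int 11 0 0 = 0) :
    Reaches auctionLoop σ ((m * m + 1) * (200 * m + 400) + 20) fun τ =>
      IsAuction m N adj f k (fun u => τ.int 7 u 0) (fun u => τ.int 8 u 0) (τ.int 10 0 0) ∧
      ∀ i, τ.int 10 0 0 = i + 1 → ∀ u < m, adj i u → m ≤ τ.int 8 u 0 := by
  let Inv : State → Prop := fun τ =>
    IsAuction m N adj f k (fun u => τ.int 7 u 0) (fun u => τ.int 8 u 0) (τ.int 10 0 0) ∧
      (m ≤ τ.int 11 0 0 → ∀ i, τ.int 10 0 0 = i + 1 → ∀ u < m, adj i u → m ≤ τ.int 8 u 0)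
  -- a bid raises one price, and a failing search sets the variable `11` to `m`
  let v : State → ℕ := fun τ =>
    (m * m - ∑ u ∈ Finset.range m, τ.int 8 u 0) + (if τ.int 11 0 0 < m then 1 else 0)
  have h0 : Inv σ := ⟨hauc, fun hm i _ u hu => by omega⟩
  refine (Reaches.loop (n := 200 * m + 180) v ?_ h0).mono ?_ ?_
  · rintro τ hτ ⟨hA, hhigh⟩ ht
    have hrep := h.agrees hτ (by decide)
    simp only [Test.Holds, IntExpr.eval, IntExpr.var, hrep.eval_sellerCount] at ht
    obtain ⟨i, hi⟩ : ∃ i, τ.int 10 0 0 = i + 1 := ⟨τ.int 10 0 0 - 1, by omega⟩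
    have hiN : i < N := by
      rcases (hA.covers_iff i).1 (.inr hi) with ⟨u, hu, hfu⟩ | rfl
      · exact (hf.adj_mate u hu i hfu).1
      · exact hk
    refine Reaches.seq (hrep.reaches_findCheapest hiN hi) (n := 60) ?_ (by omega)
    intro ρ hρ hpost
    have hρrep := hrep.agrees hρ (by decide)
    have e7 : ρ.int 7 = τ.int 7 := hρ.int_eq 7 (by decide)
    have e8 : ρ.int 8 = τ.int 8 := hρ.int_eq 8 (by decide)
    have e10 : ρ.int 10 = τ.int 10 := hρ.int_eq 10 (by decide)
    refine Reaches.ite (n := 40) ?_ ?_ (by decide)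
    · intro ht'
      simp only [Test.Holds, IntExpr.eval, IntExpr.var, hρrep.eval_sellerCount] at ht'
      rcases hpost with ⟨hm, -⟩ | ⟨b, hb, h12, hab, h11b, hlt, hmin⟩
      · omega
      rw [hi] at hA
      have hbid := hA.bid hiN hb hab hmin hlt
      refine (reaches_placeBid h12).mono le_rfl ?_
      rintro π hπ ⟨p7, p8, p10⟩
      have e11 : π.int 11 = ρ.int 11 := hπ.int_eq 11 (by decide)
      simp only [e7, e8, e10, h11b, hi] at p7 p8 p10
      have hInv : Inv π := by
        refine ⟨?_, fun hm => ?_⟩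
        · rw [p7, p8, p10]
          exact hbid
        · rw [e11] at hm
          omega
      refine ⟨hInv, ?_⟩
      have hsum : ∑ u ∈ Finset.range m, π.int 8 u 0 =
          ∑ u ∈ Finset.range m, τ.int 8 u 0 + 1 := by
        have hbm : b ∈ Finset.range m := Finset.mem_range.2 hb
        have hsub : ∑ u ∈ Finset.range m, π.int 8 u 0 =
            ∑ u ∈ Finset.range m, (fun u => π.int 8 u 0) u := rfl
        rw [hsub, p8, Finset.sum_update_of_mem hbm,
          ← Finset.add_sum_erase _ _ hbm, Finset.sdiff_singleton_eq_erase]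
        omega
      have hbound : ∑ u ∈ Finset.range m, π.int 8 u 0 ≤ m * m := by
        have := Finset.sum_le_card_nsmul (Finset.range m) (fun u => π.int 8 u 0) m
          fun u hu => hInv.1.price_le u (Finset.mem_range.1 hu)
        simpa using this
      simp only [v]
      rw [if_pos (by rw [e11]; omega), if_pos (by omega)]
      omega
    · intro ht'
      simp only [Test.Holds, IntExpr.eval, IntExpr.var, hρrep.eval_sellerCount] at ht'
      rcases hpost with ⟨hm, hall⟩ | ⟨b, hb, h12, hab, h11b, hlt, hmin⟩
      · refine Reaches.skip (by omega) ⟨⟨?_, fun _ j hj => ?_⟩, ?_⟩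
        · rw [e7, e8, e10]
          exact hA
        · rw [e10, hi] at hj
          obtain rfl : i = j := by omega
          rw [e8]
          exact hall
        · simp only [v, e8]
          rw [if_neg (by omega), if_pos (by omega)]
          omega
      · omega
  · have hv : v σ ≤ m * m + 1 := by
      simp only [v]
      split_ifs <;> omega
    refine (Nat.add_le_add_right (Nat.mul_le_mul_right _ hv) _).trans ?_
    have hc : (Test.and (.intLe (.const 1) (.var 10))
        (.intLe (.add (.var 11) (.const 1)) sellerCount)).cost = 15 := by decide
    rw [hc]
    refine Nat.add_le_add (Nat.mul_le_mul_left _ (by omega)) (by omega)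
  · rintro τ hτ ⟨⟨hA, hhigh⟩, ht⟩
    refine ⟨hA, fun i hi => hhigh ?_ i hi⟩
    have hrep := h.agrees hτ (by decide)
    simp only [Test.Holds, IntExpr.eval, IntExpr.var, hrep.eval_sellerCount] at ht
    omega

theorem Represents.reaches_startAuction (h : Represents σ m N adj c) :
    Reaches startAuction σ (100 * m + 100) fun τ =>
      (∀ u < m, τ.int 7 u 0 = σ.int 6 u 0) ∧ (∀ u < m, τ.int 8 u 0 = 0) ∧
        τ.int 10 0 0 = σ.int 9 0 0 ∧ τ.int 11 0 0 = 0 := by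
  let Inv : ℕ → State → Prop := fun n τ =>
    (∀ u < n, τ.int 7 u 0 = σ.int 6 u 0) ∧ (∀ u < n, τ.int 8 u 0 = 0)
  refine Reaches.seq (m := 100 * m + 50) (n := 20) (P := Inv m) ?_ ?_ (by omega)
  · refine (Reaches.forLoop (n := 30) m (Inv := Inv) (by decide) ?_ ?_ (by simp [Inv]) ?_).mono
      ?_ fun _ _ h => h
    · intro ρ hρ
      exact (h.agrees hρ (by decide)).eval_sellerCount
    · intro i ρ π hπ hi
      simpa only [Inv, hπ 7 (by decide), hπ 8 (by decide)] using hi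
    · rintro u ρ hu hρ hx ⟨h7, h8⟩
      have e6 : ρ.int 6 = σ.int 6 := hρ.int_eq 6 (by decide)
      refine Reaches.seq (m := 15) (n := 15) (P := fun π => π = ρ.setInt 7 u 0 (σ.int 6 u 0))
        (Reaches.setInt (by decide)
          (by simp [IntExpr.eval, IntExpr.entry, IntExpr.var, hx, e6])) ?_ le_rfl
      rintro π - rfl
      refine Reaches.setInt (by decide) ⟨fun w hw => ?_, fun w hw => ?_⟩
      · by_cases hwu : w = u
        · subst hwu
          simp [State.setInt]
        · simpa [State.setInt, hwu] using h7 w (by omega)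
      · by_cases hwu : w = u
        · subst hwu
          simp [State.setInt, IntExpr.eval, IntExpr.var, hx]
        · simpa [State.setInt, hwu, IntExpr.eval, IntExpr.var, hx] using h8 w (by omega)
    · simp only [sellerCount, IntExpr.cost, IntExpr.var]
      omega
  · rintro τ hτ ⟨h7, h8⟩
    have e9 : τ.int 9 = σ.int 9 := hτ.int_eq 9 (by decide)
    refine Reaches.seq (m := 10) (n := 10) (P := fun π => π = τ.setInt 10 0 0 (σ.int 9 0 0))
      (Reaches.setInt (by decide) (by simp [IntExpr.eval, IntExpr.var, e9])) ?_ le_rfl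
    rintro π - rfl
    refine Reaches.setInt (by decide) ⟨?_, ?_, ?_, ?_⟩
    · simpa [State.setInt] using h7
    · simpa [State.setInt] using h8
    · simp [State.setInt]
    · simp [State.setInt, IntExpr.eval]

theorem Represents.reaches_commit (h : Represents σ m N adj c) :
    Reaches commit σ (100 * m + 100) fun τ =>
      if σ.int 10 0 0 = 0 then ∀ u < m, τ.int 6 u 0 = σ.int 7 u 0 else τ.int 6 = σ.int 6 := by
  refine Reaches.ite (n := 100 * m + 90) ?_ ?_ (by
    simp only [Test.cost, IntExpr.cost, IntExpr.var]
    omega)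
  · intro ht
    simp only [Test.Holds, IntExpr.eval, IntExpr.var, Nat.le_zero] at ht
    simp only [if_pos ht]
    refine (Reaches.forLoop (n := 30) m (Inv := fun n τ => ∀ u < n, τ.int 6 u 0 = σ.int 7 u 0)
      (by decide) ?_ ?_ (by simp) ?_).mono ?_ fun _ _ h => h
    · intro ρ hρ
      exact (h.agrees hρ (by decide)).eval_sellerCount
    · intro i ρ π hπ hi
      simpa only [hπ 6 (by decide)] using hi
    · intro u ρ hu hρ hx h6
      have e7 : ρ.int 7 = σ.int 7 := hρ.int_eq 7 (by decide)
      refine Reaches.setInt (by decide) fun w hw => ?_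
      by_cases hwu : w = u
      · subst hwu
        simp [State.setInt, IntExpr.eval, IntExpr.entry, IntExpr.var, hx, e7]
      · simpa [State.setInt, hwu, IntExpr.eval, IntExpr.var, hx] using h6 w (by omega)
    · simp only [sellerCount, IntExpr.cost, IntExpr.var]
      omega
  · intro ht
    simp only [Test.Holds, IntExpr.eval, IntExpr.var, Nat.le_zero] at ht
    exact Reaches.skip (by omega) (by simp only [if_neg ht])

theorem Represents.reaches_considerItem (h : Represents σ m N adj c) {t : ℕ} (ht : t < N)
    (hst : IsGreedyStage m N adj c (fun i => σ.int 5 i 0) (fun u => σ.int 6 u 0) t) :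
    Reaches considerItem σ (200 * N + (m * m + 1) * (200 * m + 400) + 200 * m + 500) fun τ =>
      IsGreedyStage m N adj c (fun i => τ.int 5 i 0) (fun u => τ.int 6 u 0) (t + 1) := by
  refine Reaches.seq (h.reaches_selectItem (hst.exists_not_done ht))
    (n := (m * m + 1) * (200 * m + 400) + 200 * m + 300) ?_ (by omega)
  rintro τ₁ hτ₁ ⟨k, hk, h9, hk0, hfirst⟩
  have r₁ := h.agrees hτ₁ (by decide)
  have e5 : τ₁.int 5 = σ.int 5 := hτ₁.int_eq 5 (by decide)
  have e6 : τ₁.int 6 = σ.int 6 := hτ₁.int_eq 6 (by decide)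
  refine Reaches.seq (m := 20) (n := (m * m + 1) * (200 * m + 400) + 200 * m + 280)
    (P := fun π => π = τ₁.setInt 5 k 0 1)
    (Reaches.setInt (by decide) (by simp [IntExpr.eval, IntExpr.var, h9])) ?_ (by omega)
  rintro τ₂ hτ₂ hτ₂eq
  have r₂ := r₁.agrees hτ₂ (by decide)
  have d5 : (fun i => τ₂.int 5 i 0) = Function.update (fun i => σ.int 5 i 0) k 1 := by
    funext i
    simp [hτ₂eq, State.setInt, Function.update_apply, e5]
  have d6 : τ₂.int 6 = σ.int 6 := (hτ₂.int_eq 6 (by decide)).trans e6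
  have d9 : τ₂.int 9 0 0 = k + 1 := by rw [hτ₂.int_eq 9 (by decide), h9]
  refine Reaches.seq r₂.reaches_startAuction
    (n := (m * m + 1) * (200 * m + 400) + 100 * m + 180) ?_ (by omega)
  rintro τ₃ hτ₃ ⟨h7, h8, h10, h11⟩
  have r₃ := r₂.agrees hτ₃ (by decide)
  have hncov : ¬ Covers m (fun u => σ.int 6 u 0) k := fun hc => hst.done_of_covers k hc hk0
  have hauc := hst.toIsMatching.isAuction hncov (g := fun u => τ₃.int 7 u 0)
    (d := fun u => τ₃.int 8 u 0) (fun u hu => (h7 u hu).trans (by rw [d6])) h8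
  rw [← d9, ← h10] at hauc
  refine Reaches.seq (r₃.reaches_auctionLoop hst.toIsMatching hk hauc h11)
    (n := 100 * m + 100) ?_ (by omega)
  rintro τ₄ hτ₄ ⟨hA, hhigh⟩
  have r₄ := r₃.agrees hτ₄ (by decide)
  refine r₄.reaches_commit.mono le_rfl ?_
  intro τ₅ hτ₅ hcommit
  have f5 : (fun i => τ₅.int 5 i 0) = Function.update (fun i => σ.int 5 i 0) k 1 := by
    rw [← d5, hτ₅.int_eq 5 (by decide), hτ₄.int_eq 5 (by decide), hτ₃.int_eq 5 (by decide)]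
  by_cases h0 : τ₄.int 10 0 0 = 0
  · rw [if_pos h0] at hcommit
    have hcov : ∀ j, Covers m (fun u => τ₅.int 6 u 0) j ↔ Covers m (fun u => τ₄.int 7 u 0) j := by
      intro j
      constructor <;> rintro ⟨u, hu, hj⟩ <;> refine ⟨u, hu, ?_⟩
      · exact (hcommit u hu).symm.trans hj
      · exact (hcommit u hu).trans hj
    refine hst.succ hk hk0 hfirst f5 ⟨?_, ?_⟩ (.inl fun j => ?_)
    · intro u hu i hi
      exact hA.adj_mate u hu i ((hcommit u hu).symm.trans hi)
    · intro u hu w hw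
      simp only [hcommit u hu, hcommit w hw]
      exact hA.inj u hu w hw
    · rw [hcov, ← hA.covers_iff j, h0]
      simp
  · rw [if_neg h0] at hcommit
    have f6 : τ₅.int 6 = σ.int 6 := by
      rw [hcommit, hτ₄.int_eq 6 (by decide), hτ₃.int_eq 6 (by decide), d6]
    rw [f6]
    obtain ⟨i, hi⟩ : ∃ i, τ₄.int 10 0 0 = i + 1 := ⟨τ₄.int 10 0 0 - 1, by omega⟩
    rw [hi] at hA
    exact hst.succ hk hk0 hfirst f5 hst.toIsMatching
      (.inr ⟨fun _ => Iff.rfl, hA.exists_violator (hhigh i hi)⟩)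

theorem Represents.reaches_writeOutput (h : Represents σ m N adj c) :
    Reaches writeOutput σ (100 * m + 100) fun τ =>
      ∀ u < m, τ.int 4 u 0 = σ.int 6 u 0 - m := by
  refine (Reaches.forLoop (n := 30) m (Inv := fun n τ => ∀ u < n, τ.int 4 u 0 = σ.int 6 u 0 - m)
    (by decide) ?_ ?_ (by simp) ?_).mono ?_ fun _ _ h => h
  · intro ρ hρ
    exact (h.agrees hρ (by decide)).eval_sellerCount
  · intro i ρ π hπ hi
    simpa only [hπ 4 (by decide)] using hi
  · intro u ρ hu hρ hx h4
    have e6 : ρ.int 6 = σ.int 6 := hρ.int_eq 6 (by decide)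
    have hm := (h.agrees hρ (by decide)).eval_sellerCount
    refine Reaches.setInt (by decide) fun w hw => ?_
    by_cases hwu : w = u
    · subst hwu
      simp [State.setInt, IntExpr.eval, IntExpr.entry, IntExpr.var, hx, e6, hm]
    · simpa [State.setInt, hwu, IntExpr.eval, IntExpr.var, hx] using h4 w (by omega)
  · simp only [sellerCount, IntExpr.cost, IntExpr.var]
    omega

/-- A bound on the running time of the greedy algorithm with `n` items. -/
noncomputable def timeBound : Polynomial ℕ :=
  .X * (.C 200 * .X + (.X * .X + 1) * (.C 200 * .X + .C 400) + .C 200 * .X + .C 600) +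
    (.C 100 * .X + .C 200)

theorem Represents.reaches_greedyProgram (h : Represents σ m N adj c) (h5 : ∀ i, σ.int 5 i 0 = 0)
    (h6 : ∀ u, σ.int 6 u 0 = 0) :
    Reaches greedyProgram σ (timeBound.eval N) fun τ =>
      ∃ f, IsGreedy m N adj c f ∧ ∀ u < m, τ.int 4 u 0 = f u - m := by
  have hmN : m ≤ N := by
    have h1 := h.sellers
    have h2 := h.items
    omega
  have hT : N * (200 * N + (m * m + 1) * (200 * m + 400) + 200 * m + 600) + 100 +
      (100 * m + 100) ≤ timeBound.eval N := by
    have : timeBound.eval N = N * (200 * N + (N * N + 1) * (200 * N + 400) + 200 * N + 600) +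
        (100 * N + 200) := by
      simp [timeBound]
    rw [this]
    have : N * (200 * N + (m * m + 1) * (200 * m + 400) + 200 * m + 600) ≤
        N * (200 * N + (N * N + 1) * (200 * N + 400) + 200 * N + 600) := by gcongr
    rw [add_assoc]
    exact Nat.add_le_add this (by omega)
  refine Reaches.seq (m := N * (200 * N + (m * m + 1) * (200 * m + 400) + 200 * m + 600) + 100)
    (n := 100 * m + 100)
    (P := fun τ => IsGreedyStage m N adj c (fun i => τ.int 5 i 0) (fun u => τ.int 6 u 0) N)
    ?_ ?_ hT
  · refine (Reaches.forLoop (n := 200 * N + (m * m + 1) * (200 * m + 400) + 200 * m + 500) N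
      (Inv := fun t τ =>
        IsGreedyStage m N adj c (fun i => τ.int 5 i 0) (fun u => τ.int 6 u 0) t)
      (by decide) ?_ ?_ (isGreedyStage_zero h6 h5) ?_).mono ?_ fun _ _ h => h
    · intro ρ hρ
      exact (h.agrees hρ (by decide)).eval_itemCount
    · intro i ρ π hπ hi
      simpa only [hπ 5 (by decide), hπ 6 (by decide)] using hi
    · intro t ρ ht hρ _ hst
      exact (h.agrees hρ (by decide)).reaches_considerItem ht hst
    · simp only [itemCount, IntExpr.cost, IntExpr.var]
      have : N * (6 + (1 + 1 + 1 + (1 + 1 + 1) + 1) + (200 * N + (m * m + 1) * (200 * m + 400) +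
          200 * m + 500 + 8)) ≤
          N * (200 * N + (m * m + 1) * (200 * m + 400) + 200 * m + 600) :=
        Nat.mul_le_mul_left _ (by omega)
      omega
  · intro τ hτ hst
    refine (h.agrees hτ (by decide)).reaches_writeOutput.mono le_rfl ?_
    intro ρ _ h4
    exact ⟨_, hst.isGreedy, h4⟩

end RealRAM

/-! ### The matching problem of a water market -/

namespace WaterMarket

open ItemMatching

variable (I : WaterMarket)

/-- The number of seller units. -/
def sellerUnits : ℕ := ∑ s, I.sellerCap s

/-- The items offered to the seller units. Item `i < I.sellerUnits` stands for keeping the seller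
unit number `I.sellerUnits - 1 - i`, and item `I.sellerUnits + l` for selling to the `l`-th buyer
unit. The order of the former is reversed so that ties are broken in favour of keeping the last
units of a seller. -/
def Offers (i u : ℕ) : Prop :=
  i + u + 1 = I.sellerUnits ∨ ∃ (h : u < ∑ s, I.sellerCap s) (v : I.BuyerUnit),
    i = I.sellerUnits + I.buyerIndex v ∧ ((I.sellerIndex.symm ⟨u, h⟩).1, v.1) ∈ I.compat

/-- The value of an item: what the seller values the kept unit, or what the buyer pays. -/
noncomputable def itemValue (i : ℕ) : ℝ≥0 :=
  if h : I.sellerUnits - 1 - i < ∑ s, I.sellerCap s ∧ i < I.sellerUnits then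
    I.sellerValue (I.sellerIndex.symm ⟨_, h.1⟩).1 (I.sellerIndex.symm ⟨_, h.1⟩).2
  else if h : i - I.sellerUnits < ∑ b, I.buyerCap b then
    I.buyerValue (I.buyerIndex.symm ⟨_, h⟩).1 (I.buyerIndex.symm ⟨_, h⟩).2
  else 0

/-- The item of keeping the seller unit `u`. -/
def keep (u : I.SellerUnit) : ℕ := I.sellerUnits - 1 - I.sellerIndex u

/-- The item of selling to the buyer unit `v`. -/
def sell (v : I.BuyerUnit) : ℕ := I.sellerUnits + I.buyerIndex v

variable {I}

theorem sellerIndex_lt (u : I.SellerUnit) : (I.sellerIndex u : ℕ) < I.sellerUnits :=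
  (I.sellerIndex u).2

theorem keep_add (u : I.SellerUnit) : I.keep u + I.sellerIndex u + 1 = I.sellerUnits := by
  have := sellerIndex_lt u
  simp only [keep]
  omega

theorem numUnits_eq : I.numUnits = I.sellerUnits + ∑ b, I.buyerCap b := rfl

theorem keep_lt (u : I.SellerUnit) : I.keep u < I.numUnits := by
  have := keep_add u
  rw [numUnits_eq]
  omega

theorem sell_lt (v : I.BuyerUnit) : I.sell v < I.numUnits :=
  Nat.add_lt_add_left (I.buyerIndex v).2 _

theorem sell_injective : Function.Injective I.sell := fun _ _ h =>
  I.buyerIndex.injective (Fin.ext (Nat.add_left_cancel h))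

theorem keep_ne_sell (u : I.SellerUnit) (v : I.BuyerUnit) : I.keep u ≠ I.sell v := by
  have := keep_add u
  simp only [sell]
  omega

theorem exists_sellerUnit {n : ℕ} (hn : n < I.sellerUnits) :
    ∃ u : I.SellerUnit, (I.sellerIndex u : ℕ) = n :=
  ⟨I.sellerIndex.symm ⟨n, hn⟩, by simp⟩

theorem sellerIndex_inj {u w : I.SellerUnit} :
    (I.sellerIndex u : ℕ) = I.sellerIndex w ↔ u = w :=
  ⟨fun h => I.sellerIndex.injective (Fin.ext h), fun h => h ▸ rfl⟩

theorem exists_item {i : ℕ} (hi : i < I.numUnits) :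
    (∃ u, i = I.keep u) ∨ ∃ v, i = I.sell v := by
  by_cases h : i < I.sellerUnits
  · obtain ⟨u, hu⟩ := exists_sellerUnit (I := I) (n := I.sellerUnits - 1 - i) (by omega)
    exact .inl ⟨u, by simp only [keep, hu]; omega⟩
  · have hb : i - I.sellerUnits < ∑ b, I.buyerCap b := by
      rw [numUnits_eq] at hi
      omega
    refine .inr ⟨I.buyerIndex.symm ⟨_, hb⟩, ?_⟩
    simp only [sell, Equiv.apply_symm_apply]
    omega

theorem offers_keep {w : I.SellerUnit} {n : ℕ} :
    I.Offers (I.keep w) n ↔ n = I.sellerIndex w := by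
  have hw := keep_add w
  constructor
  · rintro (h | ⟨-, v, hv, -⟩)
    · omega
    · exact absurd hv (keep_ne_sell w v)
  · rintro rfl
    exact .inl hw

theorem offers_sell {v : I.BuyerUnit} {u : I.SellerUnit} :
    I.Offers (I.sell v) (I.sellerIndex u) ↔ (u.1, v.1) ∈ I.compat := by
  constructor
  · rintro (h | ⟨hu, w, hv, hc⟩)
    · simp only [sell] at h
      omega
    · obtain rfl := sell_injective hv
      simpa using hc
  · intro h
    exact .inr ⟨(I.sellerIndex u).2, v, rfl, by simpa using h⟩

theorem itemValue_keep (u : I.SellerUnit) : I.itemValue (I.keep u) = I.sellerValue u.1 u.2 := by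
  have h := keep_add u
  have hi : I.sellerUnits - 1 - I.keep u = I.sellerIndex u := by omega
  have hlt : I.sellerUnits - 1 - I.keep u < ∑ s, I.sellerCap s := hi ▸ (I.sellerIndex u).2
  have hu : I.sellerIndex.symm ⟨_, hlt⟩ = u := by
    rw [Equiv.symm_apply_eq]
    exact Fin.ext hi
  rw [itemValue, dif_pos ⟨hlt, by omega⟩, hu]

theorem itemValue_sell (v : I.BuyerUnit) : I.itemValue (I.sell v) = I.buyerValue v.1 v.2 := by
  have hi : I.sell v - I.sellerUnits = I.buyerIndex v := by simp [sell]
  have hlt : I.sell v - I.sellerUnits < ∑ b, I.buyerCap b := hi ▸ (I.buyerIndex v).2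
  have hv : I.buyerIndex.symm ⟨_, hlt⟩ = v := by
    rw [Equiv.symm_apply_eq]
    exact Fin.ext hi
  rw [itemValue, dif_neg (by simp [sell]), dif_pos hlt, hv]

theorem represents_input :
    RealRAM.Represents I.input I.sellerUnits I.numUnits I.Offers I.itemValue where
  sellers := rfl
  items := rfl
  adj_iff i hi n hn := by
    obtain ⟨u, rfl⟩ := exists_sellerUnit hn
    rcases exists_item hi with ⟨w, rfl⟩ | ⟨v, rfl⟩
    · have := keep_add w
      rw [offers_keep]
      omega
    · rw [offers_sell]
      have h1 : I.input.int 1 (I.sellerIndex u) 0 = u.1 := by simp [input]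
      have h2 : I.input.int 2 (I.sell v - I.sellerUnits) 0 = v.1 := by simp [input, sell]
      have h3 : I.input.int 3 u.1 v.1 = if (u.1, v.1) ∈ I.compat then 1 else 0 := by
        simp [input]
      rw [h1, h2, h3]
      have hs : I.sellerUnits ≤ I.sell v := by simp [sell]
      split_ifs with h
      · simp [h, hs]
      · simp only [h, false_iff]
        omega
  val_eq i hi := by
    rcases exists_item hi with ⟨u, rfl⟩ | ⟨v, rfl⟩
    · have h := keep_add u
      have h1 : 1 - (I.sellerUnits - I.keep u) = 0 := by omega
      have h2 : I.sellerUnits - 1 - I.keep u + (I.keep u - I.sellerUnits) = I.sellerIndex u := by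
        omega
      rw [h1, h2, itemValue_keep]
      simp only [input, Fin.is_lt, dif_pos, Fin.eta]
      rw [Equiv.symm_apply_apply]
    · have h1 : 1 - (I.sellerUnits - I.sell v) = 1 := by simp [sell]
      have h2 : I.sellerUnits - 1 - I.sell v + (I.sell v - I.sellerUnits) = I.buyerIndex v := by
        simp only [sell]
        omega
      rw [h1, h2, itemValue_sell]
      simp only [input, Fin.is_lt, dif_pos, Fin.eta]
      rw [Equiv.symm_apply_apply]

theorem sellerIndex_succ (s : Fin I.numSellers) (i j : Fin (I.sellerCap s)) (h : (i : ℕ) + 1 = j) :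
    (I.sellerIndex ⟨s, i⟩ : ℕ) + 1 = I.sellerIndex ⟨s, j⟩ := by
  simp only [sellerIndex, finSigmaFinEquiv_apply]
  omega

theorem buyerIndex_succ (b : Fin I.numBuyers) (i j : Fin (I.buyerCap b)) (h : (i : ℕ) + 1 = j) :
    (I.buyerIndex ⟨b, i⟩ : ℕ) + 1 = I.buyerIndex ⟨b, j⟩ := by
  simp only [buyerIndex, finSigmaFinEquiv_apply]
  omega

/-! ### The trading assignment of a greedy matching -/

open Classical in
/-- The trading assignment encoded by a matching of seller units with items. -/
noncomputable def trading (I : WaterMarket) (f : ℕ → ℕ) : Finset (I.SellerUnit × I.BuyerUnit) :=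
  Finset.univ.filter fun p => f (I.sellerIndex p.1) = I.sell p.2 + 1

variable {f : ℕ → ℕ}

theorem mem_trading {u : I.SellerUnit} {v : I.BuyerUnit} :
    (u, v) ∈ I.trading f ↔ f (I.sellerIndex u) = I.sell v + 1 := by
  simp [trading]

theorem covers_iff {i : ℕ} :
    Covers I.sellerUnits f i ↔ ∃ u : I.SellerUnit, f (I.sellerIndex u) = i + 1 := by
  constructor
  · rintro ⟨n, hn, h⟩
    obtain ⟨u, rfl⟩ := exists_sellerUnit hn
    exact ⟨u, h⟩
  · rintro ⟨u, h⟩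
    exact ⟨_, sellerIndex_lt u, h⟩

theorem exists_tight_of_ne_keep
    (hf : IsGreedy I.sellerUnits I.numUnits I.Offers I.itemValue f)
    {u : I.SellerUnit} (h : f (I.sellerIndex u) ≠ I.keep u + 1) :
    ∃ R, IsTightAt I.sellerUnits I.Offers I.itemValue f (I.keep u) R ∧
      (I.sellerIndex u : ℕ) ∈ R := by
  have hc : ¬ Covers I.sellerUnits f (I.keep u) := by
    rintro ⟨n, hn, hfn⟩
    have := (hf.adj_mate n hn _ hfn).2
    rw [offers_keep] at this
    exact h (this ▸ hfn)
  obtain ⟨R, hR⟩ := (hf.obstructed _ (keep_lt u) hc).exists_tight hf.toIsMatching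
  exact ⟨R, hR, hR.nbr_mem _ (sellerIndex_lt u) (offers_keep.2 rfl)⟩

/-- Every seller unit is assigned an item, as keeping it is always available. -/
theorem mate_ne_zero (hf : IsGreedy I.sellerUnits I.numUnits I.Offers I.itemValue f)
    (u : I.SellerUnit) : f (I.sellerIndex u) ≠ 0 := by
  by_cases h : f (I.sellerIndex u) = I.keep u + 1
  · omega
  · obtain ⟨R, hR, hu⟩ := exists_tight_of_ne_keep hf h
    obtain ⟨j, hj, -⟩ := hR.exists_item _ hu
    omega

theorem mate_cases (hf : IsGreedy I.sellerUnits I.numUnits I.Offers I.itemValue f)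
    (u : I.SellerUnit) :
    f (I.sellerIndex u) = I.keep u + 1 ∨ ∃ v, f (I.sellerIndex u) = I.sell v + 1 := by
  have h0 := mate_ne_zero hf u
  have h1 : f (I.sellerIndex u) = f (I.sellerIndex u) - 1 + 1 := by omega
  obtain ⟨hN, ho⟩ := hf.adj_mate _ (sellerIndex_lt u) _ h1
  rcases exists_item hN with ⟨w, hw⟩ | ⟨v, hv⟩
  · rw [hw, offers_keep, sellerIndex_inj] at ho
    subst ho
    exact .inl (by rw [← hw]; exact h1)
  · exact .inr ⟨v, by rw [← hv]; exact h1⟩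

theorem isTrading_trading (hf : IsGreedy I.sellerUnits I.numUnits I.Offers I.itemValue f) :
    I.IsTrading (I.trading f) where
  compatible := by
    rintro ⟨u, v⟩ h
    rw [mem_trading] at h
    exact offers_sell.1 (hf.adj_mate _ (sellerIndex_lt u) _ h).2
  seller_unique := by
    rintro ⟨u, v⟩ h ⟨u', v'⟩ h' (rfl : u = u')
    rw [mem_trading] at h h'
    rw [sell_injective (a₁ := v) (a₂ := v') (by omega)]
  buyer_unique := by
    rintro ⟨u, v⟩ h ⟨u', v'⟩ h' (rfl : v = v')
    rw [mem_trading] at h h'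
    rw [sellerIndex_inj.1 (hf.inj _ (sellerIndex_lt u) _ (sellerIndex_lt u') (by omega) (by omega))]

/-- In the tight set that rejects keeping a sold unit, all units are sold at a price no less than
the value of the unit, and all units compatible with the buyers in question belong to the set. -/
theorem isValid_trading (hf : IsGreedy I.sellerUnits I.numUnits I.Offers I.itemValue f)
    (hs : ∀ s, Monotone (I.sellerValue s))
    (hb : ∀ b, Antitone (I.buyerValue b)) : I.IsValid (I.trading f) where
  toIsTrading := isTrading_trading hf
  value_le := by
    rintro ⟨u, v⟩ h
    rw [mem_trading] at h
    have hne := keep_ne_sell u v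
    obtain ⟨R, hR, hu⟩ := exists_tight_of_ne_keep hf (u := u) (by omega)
    obtain ⟨j, hj, hbef, -⟩ := hR.exists_item _ hu
    obtain rfl : j = I.sell v := by omega
    have := hbef.le
    rwa [itemValue_keep, itemValue_sell] at this
  seller_order := by
    rintro s i j hij ⟨v, h⟩
    rw [mem_trading] at h
    have hne := keep_ne_sell ⟨s, j⟩ v
    obtain ⟨R, hR, hu⟩ := exists_tight_of_ne_keep hf (u := ⟨s, j⟩) (by omega)
    obtain ⟨k, hk, -, hcl⟩ := hR.exists_item _ hu
    obtain rfl : k = I.sell v := by omega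
    -- the buyer of the later unit is compatible with the earlier one, which is thus in `R`
    have hi : (I.sellerIndex ⟨s, i⟩ : ℕ) ∈ R := by
      refine hcl _ (sellerIndex_lt _) (offers_sell.2 ?_)
      exact (offers_sell (u := ⟨s, j⟩)).1 (hf.adj_mate _ (sellerIndex_lt _) _ h).2
    obtain ⟨k, hk, hbef, -⟩ := hR.exists_item _ hi
    rcases mate_cases hf ⟨s, i⟩ with hkeep | ⟨w, hw⟩
    · exfalso
      obtain rfl : k = I.keep ⟨s, i⟩ := by omega
      -- keeping the later unit is served before keeping the earlier one
      refine hbef.asymm ?_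
      have hle : I.itemValue (I.keep ⟨s, i⟩) ≤ I.itemValue (I.keep ⟨s, j⟩) := by
        rw [itemValue_keep, itemValue_keep]
        exact hs s (show i ≤ j from Fin.le_def.2 (by omega))
      rcases hle.lt_or_eq with hlt | heq
      · exact .inl hlt
      · have h1 := keep_add (I := I) ⟨s, i⟩
        have h2 := keep_add (I := I) ⟨s, j⟩
        have h3 := sellerIndex_succ s i j hij
        exact .inr ⟨heq.symm, by omega⟩
    · exact ⟨w, mem_trading.2 hw⟩
  buyer_order := by
    rintro b i j hij ⟨u, h⟩
    rw [mem_trading] at h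
    by_contra hcon
    have hc : ¬ Covers I.sellerUnits f (I.sell ⟨b, i⟩) := by
      rw [covers_iff]
      rintro ⟨w, hw⟩
      exact hcon ⟨w, mem_trading.2 hw⟩
    obtain ⟨R, hR⟩ := (hf.obstructed _ (sell_lt _) hc).exists_tight hf.toIsMatching
    have hu : (I.sellerIndex u : ℕ) ∈ R := by
      refine hR.nbr_mem _ (sellerIndex_lt u) (offers_sell.2 ?_)
      exact (offers_sell (v := ⟨b, j⟩)).1 (hf.adj_mate _ (sellerIndex_lt u) _ h).2
    obtain ⟨k, hk, hbef, -⟩ := hR.exists_item _ hu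
    obtain rfl : k = I.sell ⟨b, j⟩ := by omega
    -- the earlier unit of the buyer is served before the later one
    refine hbef.asymm ?_
    have hle : I.itemValue (I.sell ⟨b, j⟩) ≤ I.itemValue (I.sell ⟨b, i⟩) := by
      rw [itemValue_sell, itemValue_sell]
      exact hb b (show i ≤ j from Fin.le_def.2 (by omega))
    rcases hle.lt_or_eq with hlt | heq
    · exact .inl hlt
    · have h3 := buyerIndex_succ b i j hij
      exact .inr ⟨heq.symm, by simp only [sell]; omega⟩

/-- The items that a trading assignment gives to the seller units: the buyer unit matched with a
seller unit, or keeping it. -/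
noncomputable def itemOf (T : Finset (I.SellerUnit × I.BuyerUnit)) (u : I.SellerUnit) : ℕ :=
  open Classical in
  if h : I.SellerMatched T u then I.sell h.choose else I.keep u

variable {T : Finset (I.SellerUnit × I.BuyerUnit)}

theorem itemOf_of_mem (hT : I.IsTrading T) {u : I.SellerUnit} {v : I.BuyerUnit}
    (h : (u, v) ∈ T) : I.itemOf T u = I.sell v := by
  have hm : I.SellerMatched T u := ⟨v, h⟩
  have := hT.seller_unique _ hm.choose_spec _ h rfl
  simp only [Prod.mk.injEq, true_and] at this
  rw [itemOf, dif_pos hm, this]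

theorem itemOf_of_not_matched {u : I.SellerUnit} (h : ¬ I.SellerMatched T u) :
    I.itemOf T u = I.keep u := by
  rw [itemOf, dif_neg h]

/-- The welfare of a trading assignment is the total value of its items minus the total value of
all seller units. -/
theorem welfare_eq (hT : I.IsTrading T) :
    I.welfare T = ∑ u, (I.itemValue (I.itemOf T u) : ℝ) - ∑ u, (I.itemValue (I.keep u) : ℝ) := by
  classical
  rw [← Finset.sum_sub_distrib, welfare]
  have hinj : Set.InjOn Prod.fst (T : Set (I.SellerUnit × I.BuyerUnit)) :=
    fun p hp q hq h => hT.seller_unique p hp q hq h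
  have hsub : ∑ u, ((I.itemValue (I.itemOf T u) : ℝ) - I.itemValue (I.keep u)) =
      ∑ u ∈ T.image Prod.fst, ((I.itemValue (I.itemOf T u) : ℝ) - I.itemValue (I.keep u)) := by
    symm
    refine Finset.sum_subset (Finset.subset_univ _) fun u _ hu => ?_
    rw [itemOf_of_not_matched, sub_self]
    rintro ⟨v, hv⟩
    exact hu (Finset.mem_image.2 ⟨_, hv, rfl⟩)
  rw [hsub, Finset.sum_image hinj]
  refine Finset.sum_congr rfl fun p hp => ?_
  rw [itemOf_of_mem hT (v := p.2) hp, itemValue_sell, itemValue_keep]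

theorem offers_itemOf (hT : I.IsTrading T) (u : I.SellerUnit) :
    I.itemOf T u < I.numUnits ∧ I.Offers (I.itemOf T u) (I.sellerIndex u) := by
  by_cases h : I.SellerMatched T u
  · obtain ⟨v, hv⟩ := h
    rw [itemOf_of_mem hT hv]
    exact ⟨sell_lt v, offers_sell.2 (hT.compatible _ hv)⟩
  · rw [itemOf_of_not_matched h]
    exact ⟨keep_lt u, offers_keep.2 rfl⟩

theorem itemOf_injective (hT : I.IsTrading T) : Function.Injective (I.itemOf T) := by
  intro u w huw
  by_cases hu : I.SellerMatched T u <;> by_cases hw : I.SellerMatched T w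
  · obtain ⟨v, hv⟩ := hu
    obtain ⟨v', hv'⟩ := hw
    rw [itemOf_of_mem hT hv, itemOf_of_mem hT hv'] at huw
    obtain rfl := sell_injective huw
    exact congrArg Prod.fst (hT.buyer_unique _ hv _ hv' rfl)
  · obtain ⟨v, hv⟩ := hu
    rw [itemOf_of_mem hT hv, itemOf_of_not_matched hw] at huw
    exact absurd huw.symm (keep_ne_sell w v)
  · obtain ⟨v, hv⟩ := hw
    rw [itemOf_of_mem hT hv, itemOf_of_not_matched hu] at huw
    exact absurd huw (keep_ne_sell u v)
  · rw [itemOf_of_not_matched hu, itemOf_of_not_matched hw] at huw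
    have h1 := keep_add u
    have h2 := keep_add w
    exact sellerIndex_inj.1 (by omega)

theorem sum_range_sellerUnits (g : ℕ → ℝ≥0) :
    ∑ n ∈ Finset.range I.sellerUnits, g n = ∑ u : I.SellerUnit, g (I.sellerIndex u) := by
  rw [Finset.sum_range]
  exact (Equiv.sum_comp I.sellerIndex fun n => g n).symm

theorem isMaxWelfare_trading (hf : IsGreedy I.sellerUnits I.numUnits I.Offers I.itemValue f)
    (hs : ∀ s, Monotone (I.sellerValue s)) (hb : ∀ b, Antitone (I.buyerValue b)) :
    I.IsMaxWelfare (I.trading f) := by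
  refine ⟨isValid_trading hf hs hb, fun T hT => ?_⟩
  have hT := hT.toIsTrading
  have hT₀ := isTrading_trading hf
  rw [welfare_eq hT, welfare_eq hT₀]
  refine sub_le_sub_right ?_ _
  -- the items given by `T`, as a function of the number of the seller unit
  let a : ℕ → ℕ := fun n =>
    if h : n < ∑ s, I.sellerCap s then I.itemOf T (I.sellerIndex.symm ⟨n, h⟩) else 0
  have ha : ∀ u : I.SellerUnit, a (I.sellerIndex u) = I.itemOf T u := by
    intro u
    simp [a]
  have hmate : ∀ u, f (I.sellerIndex u) - 1 = I.itemOf (I.trading f) u := by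
    intro u
    rcases mate_cases hf u with h | ⟨v, h⟩
    · rw [itemOf_of_not_matched, h, Nat.add_sub_cancel]
      rintro ⟨v, hv⟩
      rw [mem_trading] at hv
      have := keep_ne_sell u v
      omega
    · rw [itemOf_of_mem hT₀ (mem_trading.2 h), h, Nat.add_sub_cancel]
  have key := hf.sum_le (a := a) ?_ ?_ ?_ ?_
  · simp only [sum_range_sellerUnits, ha, hmate] at key
    exact_mod_cast key
  · intro n hn
    obtain ⟨u, rfl⟩ := exists_sellerUnit hn
    exact mate_ne_zero hf u
  · intro n hn
    obtain ⟨u, rfl⟩ := exists_sellerUnit hn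
    rw [ha]
    exact (offers_itemOf hT u).1
  · intro n hn
    obtain ⟨u, rfl⟩ := exists_sellerUnit hn
    rw [ha]
    exact (offers_itemOf hT u).2
  · intro n hn k hk h
    obtain ⟨u, rfl⟩ := exists_sellerUnit (Finset.mem_range.1 hn)
    obtain ⟨w, rfl⟩ := exists_sellerUnit (Finset.mem_range.1 hk)
    rw [ha, ha] at h
    rw [itemOf_injective hT h]

theorem isOutput_trading (hf : IsGreedy I.sellerUnits I.numUnits I.Offers I.itemValue f)
    {σ : RealRAM.State} (h : ∀ n < I.sellerUnits, σ.int 4 n 0 = f n - I.sellerUnits) :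
    I.IsOutput σ (I.trading f) := by
  refine ⟨fun u v huv => ?_, fun u hu => ?_⟩
  · rw [h _ (sellerIndex_lt u), mem_trading.1 huv, sell]
    omega
  · rw [h _ (sellerIndex_lt u)]
    rcases mate_cases hf u with hk | ⟨v, hv⟩
    · have := keep_add u
      omega
    · exact absurd ⟨v, mem_trading.2 hv⟩ hu

end WaterMarket

theorem theorem1 :
    ∃ (c : RealRAM.Program) (p : Polynomial ℕ), ∀ I : WaterMarket,
      (∀ s, Monotone (I.sellerValue s)) → (∀ b, Antitone (I.buyerValue b)) →
        ∃ (σ : RealRAM.State) (t : ℕ) (T : Finset (I.SellerUnit × I.BuyerUnit)),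
          RealRAM.Runs c I.input σ t ∧ t ≤ p.eval I.numUnits ∧
            I.IsOutput σ T ∧ I.IsMaxWelfare T := by
  refine ⟨RealRAM.greedyProgram, RealRAM.timeBound, fun I hs hb => ?_⟩
  obtain ⟨σ, t, hr, ht, f, hf, hσ⟩ := I.represents_input.reaches_greedyProgram
    (fun _ => rfl) (fun _ => rfl)
  exact ⟨σ, t, I.trading f, hr, ht, WaterMarket.isOutput_trading hf hσ,
    WaterMarket.isMaxWelfare_trading hf hs hb⟩
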